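/- Let $(\Omega,\Sigma,\mu)$ be a complete $\sigma$-finite measure space and $L^0$ the space of classes of real measurable functions on $\Omega$. A Banach ideal space $E$ is a Banach space that is a linear subspace of $L^0$ and such that $y\in E$, $x\in L^0$, $|x|\le |y|$ a.e. imply $x\in E$ and $\|x\|_E\le\|y\|_E$. It has the Fatou property if $0\le x_n\uparrow x\in L^0$ a.e., $x_n\in E$ and $\sup_n\|x_n\|_E<\infty$ imply $x\in E$ and $\|x_n\|_E\uparrow\|x\|_E$; and $\operatorname{supp}E=\Omega$ means that there is no set of positive measure on which all elements of $E$ vanish a.e. For spaces $X,Y\subset L^0$, $X\hookrightarrow Y$ means $X\subset Y$ and $\|x\|_Y\le C\|x\|_X$ on $X$ for some constant $C$; $X=Y$ with equivalent norms means that the sets are equal and that $c\|x\|_X\le\|x\|_Y\le C\|x\|_X$ for some constants $c,C>0$. A Young function is a convex non-decreasing $\varphi:[0,\infty)\to[0,\infty]$ with $\varphi(0)=0$, neither identically $0$ nor identically $\infty$ on $(0,\infty)$, and left-continuous at $b_\varphi=\sup\{u>0:\varphi(u)<\infty\}$ if $b_\varphi<\infty$. Put $\varphi^{-1}(v)=\inf\{u\ge0:\varphi(u)>v\}$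 for $0\le v<\infty$. We write $\varphi_1^{-1}\varphi_2^{-1}\approx\varphi^{-1}$ for all arguments [for large arguments] (for small arguments) if there are constants $C,D>0$ [$C,D,u_0>0$] ($C,D,u_0>0$) such that $$C\varphi_1^{-1}(u)\varphi_2^{-1}(u)\le\varphi^{-1}(u)\le D\varphi_1^{-1}(u)\varphi_2^{-1}(u)$$ for all $u>0$ [all $u\ge u_0$] (all $0<u\le u_0$). For a Banach ideal space $E$ and a Young function $\varphi$ let $I_\varphi(x)=\|\varphi(|x|)\|_E$ if $\varphi(|x|)\in E$ and $I_\varphi(x)=\infty$ otherwise, $E_\varphi=\{x\in L^0: I_\varphi(cx)<\infty\text{ for some }c>0\}$ and $\|x\|_{E_\varphi}=\inf\{\lambda>0:I_\varphi(x/\lambda)\le1\}$. Further, let $X\odot Y=\{xy:x\in X,\ y\in Y\}$ with $\|z\|_{X\odot Y}=\inf\{\|x\|_X\|y\|_Y: z=xy,\ x\in X,\ y\in Y\}$, and $M(X,Y)=\{x\in L^0: xy\in Y\text{ for each }y\in X\}$ with $\|x\|_{M(X,Y)}=\sup_{\|y\|_X=1}\|xy\|_Y$. **Theorem 9.** Let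 $E$ be a Banach ideal space with the Fatou property and $\operatorname{supp}E=\Omega$. Suppose that for two Young functions $\varphi,\varphi_1$ there is a Young function $\varphi_2$ such that one of the following conditions holds: (i) $\varphi_1^{-1}\varphi_2^{-1}\approx\varphi^{-1}$ for all arguments; (ii) $\varphi_1^{-1}\varphi_2^{-1}\approx\varphi^{-1}$ for large arguments and $L^\infty\hookrightarrow E$; (iii) $\varphi_1^{-1}\varphi_2^{-1}\approx\varphi^{-1}$ for small arguments and $E\hookrightarrow L^\infty$. Then $E_{\varphi_1}\odot M(E_{\varphi_1},E_\varphi)=E_\varphi$ with equivalent norms, and $E_{\varphi_1}$ is $E_\varphi$-perfect up to equivalence of norms, that is, $M(M(E_{\varphi_1},E_\varphi),E_\varphi)=E_{\varphi_1}$ with equivalent norms. -/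

import Mathlib

open MeasureTheory Filter Topology Set
open scoped NNReal ENNReal

namespace PointwiseProduct

/-! ### Young functions -/

/-- A Young function `φ : [0, ∞) → [0, ∞]`: convex, non-decreasing, `φ 0 = 0`, neither identically
zero nor identically infinite on `(0, ∞)`, and left-continuous at
`b_φ = sup {u > 0 : φ u < ∞}` whenever `b_φ < ∞`. -/
structure YoungFunction where
  /-- The underlying function. -/
  toFun : ℝ≥0 → ℝ≥0∞
  convex : ConvexOn ℝ≥0 univ toFun
  mono : Monotone toFun
  map_zero : toFun 0 = 0
  exists_ne_zero : ∃ u : ℝ≥0, 0 < u ∧ toFun u ≠ 0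
  exists_ne_top : ∃ u : ℝ≥0, 0 < u ∧ toFun u ≠ ∞
  left_cont : ∀ b : ℝ≥0, IsLUB {u : ℝ≥0 | 0 < u ∧ toFun u < ∞} b →
    Tendsto toFun (𝓝[<] b) (𝓝 (toFun b))

namespace YoungFunction

/-- The right-continuous inverse `φ⁻¹(v) = inf {u ≥ 0 : φ u > v}` for `v ∈ [0, ∞)`.
(The set is never empty, because a Young function tends to infinity at infinity.) -/
noncomputable def inv (φ : YoungFunction) (v : ℝ≥0) : ℝ≥0 :=
  sInf {u : ℝ≥0 | (v : ℝ≥0∞) < φ.toFun u}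

/-- The inequalities `C φ₁⁻¹(u) φ₂⁻¹(u) ≤ φ⁻¹(u) ≤ D φ₁⁻¹(u) φ₂⁻¹(u)` hold, for some constants
`C, D > 0`, at all `u` in the set `S` of arguments. -/
def InvEquivOn (φ₁ φ₂ φ : YoungFunction) (S : Set ℝ≥0) : Prop :=
  ∃ C D : ℝ≥0, 0 < C ∧ 0 < D ∧ ∀ u ∈ S,
    C * (φ₁.inv u * φ₂.inv u) ≤ φ.inv u ∧ φ.inv u ≤ D * (φ₁.inv u * φ₂.inv u)

/-- `φ₁⁻¹ φ₂⁻¹ ≈ φ⁻¹` for all arguments. -/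
def InvEquivAll (φ₁ φ₂ φ : YoungFunction) : Prop :=
  InvEquivOn φ₁ φ₂ φ {u | 0 < u}

/-- `φ₁⁻¹ φ₂⁻¹ ≈ φ⁻¹` for large arguments. -/
def InvEquivLarge (φ₁ φ₂ φ : YoungFunction) : Prop :=
  ∃ u₀ : ℝ≥0, 0 < u₀ ∧ InvEquivOn φ₁ φ₂ φ {u | u₀ ≤ u}

/-- `φ₁⁻¹ φ₂⁻¹ ≈ φ⁻¹` for small arguments. -/
def InvEquivSmall (φ₁ φ₂ φ : YoungFunction) : Prop :=
  ∃ u₀ : ℝ≥0, 0 < u₀ ∧ InvEquivOn φ₁ φ₂ φ {u | 0 < u ∧ u ≤ u₀}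

theorem measurable_toReal (φ : YoungFunction) :
    Measurable fun r : ℝ => (φ.toFun ‖r‖₊).toReal :=
  (φ.mono.measurable.comp measurable_nnnorm).ennreal_toReal

end YoungFunction

variable {Ω : Type*} [MeasurableSpace Ω] {μ : Measure Ω}

/-- The class of `φ(|x|)` in `L⁰`; meaningful when `φ(|x|)` is finite almost everywhere. -/
noncomputable def YoungFunction.compAbs (φ : YoungFunction) (x : Ω →ₘ[μ] ℝ) : Ω →ₘ[μ] ℝ :=
  AEEqFun.compMeasurable (fun r : ℝ => (φ.toFun ‖r‖₊).toReal) φ.measurable_toReal x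

/-! ### Spaces of measurable functions -/

/-- A set of classes of real measurable functions together with a functional on it (the value of
the functional outside the set plays no role). This is only the common type of the spaces
`E`, `E_φ`, `E ⊙ F`, `M(E, F)`, `L^∞`; the laws of a Banach ideal space are in
`IsBanachIdealSpace`. -/
structure FunctionSpace (μ : Measure Ω) where
  /-- The elements of the space. -/
  carrier : Set (Ω →ₘ[μ] ℝ)
  /-- The (quasi-)norm. -/
  norm : (Ω →ₘ[μ] ℝ) → ℝ≥0∞

namespace FunctionSpace

/-- `E` is a Banach ideal space: a linear subspace of `L⁰`, with a complete norm, that has the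
ideal property. (Saturation is the separate condition `HasFullSupport`.) -/
structure IsBanachIdealSpace (E : FunctionSpace μ) : Prop where
  zero_mem : 0 ∈ E.carrier
  add_mem : ∀ x ∈ E.carrier, ∀ y ∈ E.carrier, x + y ∈ E.carrier
  smul_mem : ∀ (c : ℝ), ∀ x ∈ E.carrier, c • x ∈ E.carrier
  norm_ne_top : ∀ x ∈ E.carrier, E.norm x ≠ ∞
  eq_zero_of_norm : ∀ x ∈ E.carrier, E.norm x = 0 → x = 0
  norm_smul : ∀ (c : ℝ), ∀ x ∈ E.carrier, E.norm (c • x) = ENNReal.ofReal |c| * E.norm x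
  norm_add_le : ∀ x ∈ E.carrier, ∀ y ∈ E.carrier, E.norm (x + y) ≤ E.norm x + E.norm y
  ideal : ∀ y ∈ E.carrier, ∀ x : Ω →ₘ[μ] ℝ, (∀ᵐ t ∂μ, |x t| ≤ |y t|) →
    x ∈ E.carrier ∧ E.norm x ≤ E.norm y
  complete : ∀ x : ℕ → (Ω →ₘ[μ] ℝ), (∀ n, x n ∈ E.carrier) →
    (∀ ε : ℝ≥0∞, 0 < ε → ∃ N : ℕ, ∀ m ≥ N, ∀ n ≥ N, E.norm (x m - x n) ≤ ε) →
    ∃ z ∈ E.carrier, Tendsto (fun n => E.norm (x n - z)) atTop (𝓝 0)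

/-- `supp E = Ω`: there is no set of positive measure on which all the elements of `E` vanish.
For a Banach ideal space over a σ-finite measure this says that `E` is saturated. -/
def HasFullSupport (E : FunctionSpace μ) : Prop :=
  ∀ A : Set Ω, MeasurableSet A → 0 < μ A → ∃ x ∈ E.carrier, ¬ ∀ᵐ t ∂μ, t ∈ A → x t = 0

/-- The Fatou property: if `0 ≤ xₙ ↑ x ∈ L⁰` with `xₙ ∈ E` and `sup ‖xₙ‖ < ∞`, then `x ∈ E` and
`‖xₙ‖ ↑ ‖x‖` (the norms increase by the ideal property). -/
def HasFatouProperty (E : FunctionSpace μ) : Prop :=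
  ∀ (x : ℕ → (Ω →ₘ[μ] ℝ)) (z : Ω →ₘ[μ] ℝ), (∀ n, x n ∈ E.carrier) →
    (∀ᵐ t ∂μ, (∀ n, 0 ≤ x n t) ∧ Monotone (fun n => x n t) ∧
      Tendsto (fun n => x n t) atTop (𝓝 (z t))) →
    (⨆ n, E.norm (x n)) < ∞ →
    z ∈ E.carrier ∧ Tendsto (fun n => E.norm (x n)) atTop (𝓝 (E.norm z))

/-- The continuous embedding `X ↪ Y`. -/
def Embeds (X Y : FunctionSpace μ) : Prop :=
  X.carrier ⊆ Y.carrier ∧ ∃ C : ℝ≥0, ∀ x ∈ X.carrier, Y.norm x ≤ C * X.norm x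

/-- `X = Y` as sets, with equivalent norms. -/
def EqWithEquivNorms (X Y : FunctionSpace μ) : Prop :=
  X.carrier = Y.carrier ∧ ∃ c C : ℝ≥0, 0 < c ∧ 0 < C ∧ ∀ x ∈ X.carrier,
    c * X.norm x ≤ Y.norm x ∧ Y.norm x ≤ C * X.norm x

/-- The space `L^∞` with the essential supremum norm. -/
noncomputable def linfty (μ : Measure Ω) : FunctionSpace μ where
  carrier := {x | eLpNorm x ∞ μ < ∞}
  norm x := eLpNorm x ∞ μ

/-- The pointwise product `X ⊙ Y = {x y : x ∈ X, y ∈ Y}` with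
`‖z‖ = inf {‖x‖ ‖y‖ : z = x y, x ∈ X, y ∈ Y}`. -/
noncomputable def prod (X Y : FunctionSpace μ) : FunctionSpace μ where
  carrier := {z | ∃ x ∈ X.carrier, ∃ y ∈ Y.carrier, z = x * y}
  norm z := ⨅ (x ∈ X.carrier) (y ∈ Y.carrier) (_ : z = x * y), X.norm x * Y.norm y

/-- The space of multipliers `M(X, Y) = {x ∈ L⁰ : x y ∈ Y for each y ∈ X}` with the operator norm
`‖x‖ = sup {‖x y‖ : y ∈ X, ‖y‖ = 1}`. -/
noncomputable def multipliers (X Y : FunctionSpace μ) : FunctionSpace μ where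
  carrier := {x | ∀ y ∈ X.carrier, x * y ∈ Y.carrier}
  norm x := ⨆ (y ∈ X.carrier) (_ : X.norm y = 1), Y.norm (x * y)

open Classical in
/-- The semimodular `I_φ(x) = ‖φ(|x|)‖_E` if `φ(|x|) ∈ E` (in particular `φ(|x|)` is finite almost
everywhere), and `I_φ(x) = ∞` otherwise. -/
noncomputable def modular (E : FunctionSpace μ) (φ : YoungFunction) (x : Ω →ₘ[μ] ℝ) : ℝ≥0∞ :=
  if (∀ᵐ t ∂μ, φ.toFun ‖x t‖₊ < ∞) ∧ φ.compAbs x ∈ E.carrier then E.norm (φ.compAbs x) else ∞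

/-- The Calderón–Lozanovskiĭ space `E_φ = {x ∈ L⁰ : I_φ(c x) < ∞ for some c > 0}` with the
Luxemburg–Nakano norm `‖x‖ = inf {l > 0 : I_φ(x / l) ≤ 1}`. -/
noncomputable def calderonLozanovskii (E : FunctionSpace μ) (φ : YoungFunction) :
    FunctionSpace μ where
  carrier := {x | ∃ c : ℝ, 0 < c ∧ E.modular φ (c • x) < ∞}
  norm x := ⨅ (l : ℝ≥0) (_ : 0 < l ∧ E.modular φ ((l : ℝ)⁻¹ • x) ≤ 1), (l : ℝ≥0∞)

/-- `X` is `Y`-perfect up to equivalence of norms: `M(M(X, Y), Y) = X` with equivalent norms. -/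
def IsPerfectUpToEquiv (X Y : FunctionSpace μ) : Prop :=
  EqWithEquivNorms (multipliers (multipliers X Y) Y) X

end FunctionSpace

end PointwiseProduct

/-!
The inverse `φ⁻¹` is adjoint to `φ`: `φ u ≤ v ↔ u ≤ φ⁻¹ v` (`YoungFunction.toFun_le_iff`). Hence
the unit ball of `E_φ` consists of the `x` with `|x| ≤ φ⁻¹(|f|)` for some `f` in the unit ball of
`E`, and since `φ⁻¹ (k v) ≤ k φ⁻¹ v` for `k ≥ 1`, the radius of the ball of `E` may be changed at
the expense of a factor (`FunctionSpace.InBall`). All arguments are carried out with such majorants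
`f`, so that the jumps of Young functions to `∞` play no role.

By completeness and σ-finiteness `E` has a weak unit `e`. Adding to `f` a suitable multiple of `e`
(in the case of large arguments, a constant), and taking `f` in a small ball in the case of small
arguments, the values of `f` are confined to the arguments at which `φ₁⁻¹ φ₂⁻¹ ≈ φ⁻¹`; this
reduces the three cases to one (`FunctionSpace.InvEquivAlong`, which is symmetric in `φ₁` and
`φ₂`). Then:

* `E_φ₁ ⊙ E_φ₂ = E_φ`: if `|xᵢ| ≤ φᵢ⁻¹(|fᵢ|)`, then `|x₁ x₂|` is at most a multiple of
  `φ⁻¹(|f₁| + |f₂| + e)`; if `|z| ≤ φ⁻¹(f)`, then `z = φ₁⁻¹(f) · (z / φ₁⁻¹(f))` and the second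
  factor is at most a multiple of `φ₂⁻¹(f)`.
* `M(E_φ₁, E_φ) = E_φ₂` (`InvEquivAlong.multipliers_eq`). One inclusion is the previous item. For
  the other, let `z` be outside the ball of radius `l` of `E_φ₂`. Truncations of `φ₂(|z| / l)` and
  the Fatou property give `v ∈ E`, of norm not too small and not too large, with
  `l φ₂⁻¹(v) ≤ 2 |z|`. Then `y = φ₁⁻¹(v)` is in a fixed ball of `E_φ₁`, while `|z y|` is at least a
  multiple of `l φ⁻¹(v)`, so that its norm in `E_φ` is at least a multiple of `l`. That
  multiplication by `z` is bounded follows from the completeness of `E`.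

The factorization follows, and `M(M(E_φ₁, E_φ), E_φ) = M(E_φ₂, E_φ) = E_φ₁` by symmetry.
-/

namespace PointwiseProduct

variable {Ω : Type*} [MeasurableSpace Ω] {μ : Measure Ω}

/-! ### Young functions and their inverses -/

namespace YoungFunction

theorem map_mul_le (φ : YoungFunction) {s : ℝ≥0} (hs : s ≤ 1) (u : ℝ≥0) :
    φ.toFun (s * u) ≤ s * φ.toFun u := by
  have h := φ.convex.2 (mem_univ (0 : ℝ≥0)) (mem_univ u) (zero_le (a := 1 - s)) (zero_le (a := s))
    (tsub_add_cancel_of_le hs)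
  simpa [φ.map_zero, ENNReal.smul_def] using h

/-- A Young function grows at least linearly, so its inverse grows at most linearly. -/
theorem exists_lt_toFun (φ : YoungFunction) :
    ∃ a b : ℝ≥0, ∀ v : ℝ≥0, (v : ℝ≥0∞) < φ.toFun (a + b * v) := by
  obtain ⟨u, hu, hφu⟩ := φ.exists_ne_zero
  obtain ⟨c, hc0, hcu⟩ := ENNReal.lt_iff_exists_nnreal_btwn.1 (pos_iff_ne_zero.2 hφu)
  have hc : 0 < c := by exact_mod_cast hc0
  refine ⟨u, u / c, fun v => ?_⟩
  have ht : (1 + v / c : ℝ≥0) ≠ 0 := by positivity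
  have h := φ.map_mul_le (s := (1 + v / c)⁻¹) (inv_le_one_of_one_le₀ (by simp))
    ((1 + v / c) * u)
  rw [inv_mul_cancel_left₀ ht] at h
  have hlt : (c : ℝ≥0∞) < ((1 + v / c)⁻¹ : ℝ≥0) * φ.toFun ((1 + v / c) * u) := hcu.trans_le h
  have he : u + u / c * v = (1 + v / c) * u := by field_simp
  rw [he]
  by_contra! hle
  have h2 : (c : ℝ≥0∞) < ((1 + v / c)⁻¹ : ℝ≥0) * (v : ℝ≥0∞) := hlt.trans_le (by gcongr)
  have h3 : c < (1 + v / c)⁻¹ * v := by exact_mod_cast h2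
  have h4 : (1 + v / c)⁻¹ * v ≤ c := by
    rw [inv_mul_le_iff₀ (by positivity)]
    have : (1 + v / c) * c = c + v := by field_simp
    rw [this]; exact le_add_self
  exact absurd h3 (not_lt.2 h4)

theorem nonempty_lt (φ : YoungFunction) (v : ℝ≥0) :
    {u : ℝ≥0 | (v : ℝ≥0∞) < φ.toFun u}.Nonempty := by
  obtain ⟨a, b, h⟩ := φ.exists_lt_toFun
  exact ⟨_, h v⟩

theorem inv_le_of_lt (φ : YoungFunction) {u v : ℝ≥0} (h : (v : ℝ≥0∞) < φ.toFun u) :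
    φ.inv v ≤ u := csInf_le' h

theorem exists_inv_le (φ : YoungFunction) :
    ∃ a b : ℝ≥0, ∀ v : ℝ≥0, φ.inv v ≤ a + b * v := by
  obtain ⟨a, b, h⟩ := φ.exists_lt_toFun
  exact ⟨a, b, fun v => φ.inv_le_of_lt (h v)⟩

theorem le_inv_of_le (φ : YoungFunction) {u v : ℝ≥0} (h : φ.toFun u ≤ v) : u ≤ φ.inv v := by
  refine le_csInf (φ.nonempty_lt v) fun u' hu' => ?_
  by_contra! hlt
  exact absurd (hu'.trans_le (φ.mono hlt.le)) (not_lt.2 h)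

theorem toFun_le_of_lt_inv (φ : YoungFunction) {u v : ℝ≥0} (h : u < φ.inv v) :
    φ.toFun u ≤ v := by
  by_contra! hlt
  exact absurd (φ.inv_le_of_lt hlt) (not_le.2 h)

/-- Convexity gives left-continuity in the interior of the domain of finiteness, and the definition
of a Young function gives it at the right endpoint. -/
theorem toFun_inv_le (φ : YoungFunction) (v : ℝ≥0) : φ.toFun (φ.inv v) ≤ v := by
  set b := φ.inv v with hb
  rcases eq_zero_or_pos b with h0 | hpos
  · simp [h0, φ.map_zero]
  have hbelow : ∀ u < b, φ.toFun u ≤ v := fun u hu => φ.toFun_le_of_lt_inv hu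
  by_cases hfin : ∃ w, b < w ∧ φ.toFun w ≠ ∞
  · obtain ⟨w, hbw, hw⟩ := hfin
    have hw0 : 0 < w := hpos.trans hbw
    have key : ∀ s : ℝ≥0, 0 < s → s ≤ b / w → φ.toFun b ≤ v + s * φ.toFun w := by
      intro s hs hsb
      have hs1 : s < 1 := hsb.trans_lt ((div_lt_one hw0).2 hbw)
      have hsw : s * w ≤ b := by
        calc s * w ≤ b / w * w := by gcongr
          _ = b := by field_simp
      have h1s : 0 < 1 - s := tsub_pos_of_lt hs1
      set u := (b - s * w) / (1 - s) with hu
      have hcomb : (1 - s) * u + s * w = b := by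
        rw [hu, mul_div_cancel₀ _ h1s.ne', tsub_add_cancel_of_le hsw]
      have hub : u < b := by
        by_contra! hle
        have : b < (1 - s) * u + s * w := by
          calc b = (1 - s) * b + s * b := by
                rw [← add_mul, tsub_add_cancel_of_le hs1.le, one_mul]
            _ < (1 - s) * u + s * w := by
                apply add_lt_add_of_le_of_lt
                · gcongr
                · gcongr
        exact absurd hcomb this.ne'
      have h := φ.convex.2 (mem_univ u) (mem_univ w) (zero_le (a := 1 - s)) (zero_le (a := s))
        (tsub_add_cancel_of_le hs1.le)
      simp only [smul_eq_mul, ENNReal.smul_def] at h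
      rw [hcomb] at h
      refine h.trans ?_
      gcongr
      calc ((1 - s : ℝ≥0) : ℝ≥0∞) * φ.toFun u ≤ 1 * v := by
            gcongr
            · exact_mod_cast tsub_le_self
            · exact hbelow u hub
        _ = v := one_mul _
    have hlim : Tendsto (fun s : ℝ≥0 => (v : ℝ≥0∞) + s * φ.toFun w) (𝓝[>] 0) (𝓝 (v + 0)) := by
      refine (tendsto_const_nhds.add ?_)
      have : Tendsto (fun s : ℝ≥0 => (s : ℝ≥0∞) * φ.toFun w) (𝓝 0)
          (𝓝 (((0 : ℝ≥0) : ℝ≥0∞) * φ.toFun w)) :=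
        ENNReal.Tendsto.mul_const (ENNReal.tendsto_coe.2 tendsto_id) (Or.inr hw)
      simpa using this.mono_left nhdsWithin_le_nhds
    rw [add_zero] at hlim
    refine ge_of_tendsto hlim ?_
    have : Ioc (0 : ℝ≥0) (b / w) ∈ 𝓝[>] (0 : ℝ≥0) := Ioc_mem_nhdsGT (by positivity)
    filter_upwards [this] with s hs using key s hs.1 hs.2
  · push Not at hfin
    have hlub : IsLUB {u : ℝ≥0 | 0 < u ∧ φ.toFun u < ∞} b := by
      refine ⟨fun u hu => ?_, fun c hc => ?_⟩
      · by_contra! hlt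
        exact absurd (hfin u hlt) hu.2.ne
      · refine le_of_forall_lt fun u hu => ?_
        obtain ⟨u', h1, h2⟩ := exists_between hu
        exact h1.trans_le (hc ⟨h1.pos, (hbelow u' h2).trans_lt ENNReal.coe_lt_top⟩)
    have : (𝓝[<] b).NeBot := nhdsLT_neBot_of_exists_lt ⟨0, hpos⟩
    refine le_of_tendsto (φ.left_cont b hlub) ?_
    filter_upwards [self_mem_nhdsWithin] with u hu using hbelow u hu

theorem toFun_le_iff (φ : YoungFunction) {u v : ℝ≥0} : φ.toFun u ≤ v ↔ u ≤ φ.inv v :=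
  ⟨φ.le_inv_of_le, fun h => (φ.mono h).trans (φ.toFun_inv_le v)⟩

theorem inv_mono (φ : YoungFunction) : Monotone φ.inv := fun v w h =>
  φ.toFun_le_iff.1 ((φ.toFun_inv_le v).trans (by exact_mod_cast h))

theorem inv_mul_le (φ : YoungFunction) {k : ℝ≥0} (hk : 1 ≤ k) (v : ℝ≥0) :
    φ.inv (k * v) ≤ k * φ.inv v := by
  have hk0 : 0 < k := zero_lt_one.trans_le hk
  have h : k⁻¹ * φ.inv (k * v) ≤ φ.inv v := by
    refine φ.toFun_le_iff.1 ((φ.map_mul_le (inv_le_one_of_one_le₀ hk) _).trans ?_)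
    calc ((k⁻¹ : ℝ≥0) : ℝ≥0∞) * φ.toFun (φ.inv (k * v)) ≤ (k⁻¹ : ℝ≥0) * ((k * v : ℝ≥0) : ℝ≥0∞) := by
          gcongr; exact φ.toFun_inv_le _
      _ = v := by rw [← ENNReal.coe_mul, inv_mul_cancel_left₀ hk0.ne']
  rwa [inv_mul_le_iff₀ hk0] at h

theorem inv_pos (φ : YoungFunction) {v : ℝ≥0} (hv : 0 < v) : 0 < φ.inv v := by
  obtain ⟨u, hu, hφu⟩ := φ.exists_ne_top
  lift φ.toFun u to ℝ≥0 using hφu with c hc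
  have hs : v / (v + c) ≤ 1 := div_le_one_of_le₀ (by simp) (by positivity)
  have h : v / (v + c) * u ≤ φ.inv v := by
    refine φ.toFun_le_iff.1 ((φ.map_mul_le hs u).trans ?_)
    rw [← hc, ← ENNReal.coe_mul]
    have : v / (v + c) * c ≤ v := by
      rw [div_mul_eq_mul_div, div_le_iff₀ (by positivity)]
      gcongr; simp
    exact_mod_cast this
  exact lt_of_lt_of_le (by positivity) h

theorem measurable_inv (φ : YoungFunction) : Measurable fun r : ℝ => (φ.inv ‖r‖₊ : ℝ) :=
  (φ.inv_mono.measurable.comp measurable_nnnorm).coe_nnreal_real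

end YoungFunction

/-! ### Banach ideal spaces -/

/-- An estimate by the values above an infimum passes to the infimum. -/
theorem ennreal_le_mul_of_forall_gt {a b : ℝ≥0∞} {k : ℝ≥0} (ha : a ≠ ∞)
    (h : ∀ l : ℝ≥0, a < l → b ≤ k * l) : b ≤ k * a := by
  rcases eq_or_ne k 0 with rfl | hk
  · lift a to ℝ≥0 using ha
    simpa using h (a + 1) (by exact_mod_cast lt_add_one a)
  · have hk' : (k : ℝ≥0∞) ≠ 0 := by exact_mod_cast hk
    rw [← ENNReal.div_le_iff' hk' ENNReal.coe_ne_top]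
    refine le_of_forall_gt_imp_ge_of_dense fun c hc => ?_
    induction c with
    | top => exact le_top
    | coe c =>
      rw [ENNReal.div_le_iff' hk' ENNReal.coe_ne_top]
      exact h c hc

namespace FunctionSpace

namespace IsBanachIdealSpace

variable {E : FunctionSpace μ}

theorem norm_zero (hE : E.IsBanachIdealSpace) : E.norm 0 = 0 := by
  simpa using hE.norm_smul 0 0 hE.zero_mem

theorem of_abs_le (hE : E.IsBanachIdealSpace) {x y : Ω →ₘ[μ] ℝ} (hy : y ∈ E.carrier)
    (h : ∀ᵐ t ∂μ, |x t| ≤ |y t|) : x ∈ E.carrier ∧ E.norm x ≤ E.norm y :=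
  hE.ideal y hy x h

theorem abs_mem (hE : E.IsBanachIdealSpace) {x : Ω →ₘ[μ] ℝ} (hx : x ∈ E.carrier) :
    |x| ∈ E.carrier ∧ E.norm |x| ≤ E.norm x := by
  refine hE.of_abs_le hx ?_
  filter_upwards [AEEqFun.coeFn_abs x] with t ht
  simp [ht]

theorem norm_smul_le (hE : E.IsBanachIdealSpace) {x : Ω →ₘ[μ] ℝ} (hx : x ∈ E.carrier) (c : ℝ≥0)
    {K : ℝ≥0∞} (hK : E.norm x ≤ K) : E.norm ((c : ℝ) • x) ≤ c * K := by
  rw [hE.norm_smul _ x hx, abs_of_nonneg (NNReal.coe_nonneg c), ENNReal.ofReal_coe_nnreal]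
  gcongr

theorem norm_sub_rev_le (hE : E.IsBanachIdealSpace) {x y : Ω →ₘ[μ] ℝ} (h : x - y ∈ E.carrier) :
    E.norm (y - x) ≤ E.norm (x - y) := by
  refine (hE.of_abs_le h ?_).2
  filter_upwards [AEEqFun.coeFn_sub x y, AEEqFun.coeFn_sub y x] with t h1 h2
  rw [h1, h2, Pi.sub_apply, Pi.sub_apply, abs_sub_comm]

theorem sub_mem (hE : E.IsBanachIdealSpace) {x y : Ω →ₘ[μ] ℝ} (hx : x ∈ E.carrier)
    (hy : y ∈ E.carrier) : x - y ∈ E.carrier := by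
  have := hE.add_mem x hx _ (hE.smul_mem (-1) y hy)
  rwa [neg_one_smul, ← sub_eq_add_neg] at this

theorem eq_zero_of_forall_norm_le (hE : E.IsBanachIdealSpace) {x : Ω →ₘ[μ] ℝ}
    (hx : x ∈ E.carrier) {u : ℕ → ℝ≥0∞} (hu : Tendsto u atTop (𝓝 0))
    (h : ∀ᶠ n in atTop, E.norm x ≤ u n) : x = 0 :=
  hE.eq_zero_of_norm x hx (le_antisymm (ge_of_tendsto hu h) bot_le)

/-- A bounded sequence `f n` in a Banach ideal space has, up to the factors `2⁻ⁿ`, a common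
majorant in the space, namely `∑ 2⁻ⁿ |f n|`. -/
theorem exists_majorant (hE : E.IsBanachIdealSpace) (f : ℕ → Ω →ₘ[μ] ℝ)
    (hf : ∀ n, f n ∈ E.carrier) (K : ℝ≥0) (hK : ∀ n, E.norm (f n) ≤ K) :
    ∃ F ∈ E.carrier, ∀ n, ∀ᵐ t ∂μ, (2⁻¹ : ℝ) ^ n * |f n t| ≤ |F t| := by
  set S : ℕ → Ω →ₘ[μ] ℝ := fun n => Nat.rec 0 (fun n s => s + (2⁻¹ : ℝ) ^ n • |f n|) n with hS
  have hSsucc : ∀ n, S (n + 1) = S n + (2⁻¹ : ℝ) ^ n • |f n| := fun n => rfl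
  have hterm : ∀ n, (2⁻¹ : ℝ) ^ n • |f n| ∈ E.carrier := fun n =>
    hE.smul_mem _ _ (hE.abs_mem (hf n)).1
  have htermn : ∀ n, E.norm ((2⁻¹ : ℝ) ^ n • |f n|) ≤ ((2⁻¹ ^ n * K : ℝ≥0) : ℝ≥0∞) := by
    intro n
    have := hE.norm_smul_le (hE.abs_mem (hf n)).1 (2⁻¹ ^ n) ((hE.abs_mem (hf n)).2.trans (hK n))
    simpa using this
  have hSmem : ∀ n, S n ∈ E.carrier := by
    intro n
    induction n with
    | zero => exact hE.zero_mem
    | succ n ih => rw [hSsucc]; exact hE.add_mem _ ih _ (hterm n)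
  have hSae : ∀ᵐ t ∂μ, ∀ n, S (n + 1) t = S n t + (2⁻¹ : ℝ) ^ n * |f n t| := by
    refine ae_all_iff.2 fun n => ?_
    filter_upwards [AEEqFun.coeFn_add (S n) ((2⁻¹ : ℝ) ^ n • |f n|),
      AEEqFun.coeFn_smul ((2⁻¹ : ℝ) ^ n) |f n|, AEEqFun.coeFn_abs (f n)] with t h1 h2 h3
    rw [hSsucc, h1, Pi.add_apply, h2, Pi.smul_apply, h3, smul_eq_mul]
  have hdist : ∀ n k, E.norm (S (n + k) - S n) + ((2 * 2⁻¹ ^ (n + k) * K : ℝ≥0) : ℝ≥0∞)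
      ≤ ((2 * 2⁻¹ ^ n * K : ℝ≥0) : ℝ≥0∞) := by
    intro n k
    induction k with
    | zero => simp [hE.norm_zero]
    | succ k ih =>
      have h1 : S (n + (k + 1)) - S n = (S (n + k) - S n) + (2⁻¹ : ℝ) ^ (n + k) • |f (n + k)| := by
        rw [← add_assoc, hSsucc]; abel
      have h2 := hE.norm_add_le _ (hE.sub_mem (hSmem (n + k)) (hSmem n)) _ (hterm (n + k))
      rw [← h1] at h2
      refine le_trans ?_ ih
      calc _ ≤ E.norm (S (n + k) - S n) + ((2⁻¹ ^ (n + k) * K : ℝ≥0) : ℝ≥0∞)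
            + ((2 * 2⁻¹ ^ (n + (k + 1)) * K : ℝ≥0) : ℝ≥0∞) := by
            gcongr; exact h2.trans (by gcongr; exact htermn _)
        _ = _ := by
            rw [add_assoc, ← ENNReal.coe_add]
            congr 2
            rw [← add_assoc, pow_succ, ← NNReal.coe_inj]
            push_cast
            ring
  have hdist' : ∀ n m, n ≤ m → E.norm (S m - S n) ≤ ((2 * 2⁻¹ ^ n * K : ℝ≥0) : ℝ≥0∞) := by
    intro n m h
    obtain ⟨k, rfl⟩ := Nat.exists_eq_add_of_le h
    exact le_self_add.trans (hdist n k)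
  have hlim : Tendsto (fun n : ℕ => ((2 * 2⁻¹ ^ n * K : ℝ≥0) : ℝ≥0∞)) atTop (𝓝 0) := by
    rw [← ENNReal.coe_zero, ENNReal.tendsto_coe]
    have : Tendsto (fun n : ℕ => (2⁻¹ : ℝ≥0) ^ n) atTop (𝓝 0) :=
      NNReal.tendsto_pow_atTop_nhds_zero_of_lt_one (by norm_num)
    simpa using (this.const_mul 2).mul_const K
  obtain ⟨F, hF, hFlim⟩ := hE.complete S hSmem (by
    intro ε hε
    obtain ⟨N, hN⟩ := (hlim.eventually (ge_mem_nhds hε)).exists_forall_of_atTop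
    refine ⟨N, fun m hm n hn => ?_⟩
    rcases le_total n m with h | h
    · exact (hdist' n m h).trans (hN n hn)
    · exact (hE.norm_sub_rev_le (hE.sub_mem (hSmem n) (hSmem m))).trans
        ((hdist' m n h).trans (hN m hm)))
  have hmono : ∀ᵐ t ∂μ, Monotone fun n => S n t := by
    filter_upwards [hSae] with t ht
    refine monotone_nat_of_le_succ fun n => ?_
    rw [ht n]
    have : (0 : ℝ) ≤ 2⁻¹ ^ n * |f n t| := by positivity
    linarith
  have hle : ∀ m, ∀ᵐ t ∂μ, S m t ≤ F t := by
    intro m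
    -- `(S m - F)⁺ ≤ |S n - F|` for `n ≥ m`, so its norm is zero.
    have hn : ∀ n ≥ m, ∀ᵐ t ∂μ, |(AEEqFun.posPart (S m - F)) t| ≤ |(S n - F) t| := by
      intro n hmn
      filter_upwards [hmono, AEEqFun.coeFn_posPart (S m - F), AEEqFun.coeFn_sub (S m) F,
        AEEqFun.coeFn_sub (S n) F] with t h1 h2 h3 h4
      rw [h2, h3, h4, Pi.sub_apply, Pi.sub_apply, abs_of_nonneg (le_max_right _ _)]
      have : S m t ≤ S n t := h1 hmn
      exact max_le ((by linarith : S m t - F t ≤ S n t - F t).trans (le_abs_self _)) (abs_nonneg _)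
    have hmem := (hE.of_abs_le (hE.sub_mem (hSmem m) hF) (hn m le_rfl)).1
    have h0 := hE.eq_zero_of_forall_norm_le hmem hFlim (by
      filter_upwards [eventually_ge_atTop m] with n hmn
      exact (hE.of_abs_le (hE.sub_mem (hSmem n) hF) (hn n hmn)).2)
    have h0' : (AEEqFun.posPart (S m - F) : Ω → ℝ) =ᵐ[μ] 0 := by rw [h0]; exact AEEqFun.coeFn_zero
    filter_upwards [h0', AEEqFun.coeFn_posPart (S m - F), AEEqFun.coeFn_sub (S m) F]
      with t h1 h2 h3
    rw [h2, h3, Pi.sub_apply, Pi.zero_apply] at h1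
    have := le_max_left (S m t - F t) 0
    linarith
  refine ⟨F, hF, fun n => ?_⟩
  filter_upwards [hle (n + 1), hSae, hmono, (AEEqFun.coeFn_zero : ⇑(0 : Ω →ₘ[μ] ℝ) =ᵐ[μ] 0)]
    with t h1 h2 h3 h4
  have h5 : S 0 t ≤ S n t := h3 (Nat.zero_le n)
  have h6 : S 0 t = 0 := h4
  rw [h2 n] at h1
  exact (by linarith : (2⁻¹ : ℝ) ^ n * |f n t| ≤ F t).trans (le_abs_self _)

/-- A Banach ideal space of full support over a σ-finite measure has a weak unit. It is found by
exhaustion: a majorant of a sequence whose supports have nearly maximal measure. -/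
theorem exists_weak_unit [SigmaFinite μ] (hE : E.IsBanachIdealSpace) (hsupp : E.HasFullSupport) :
    ∃ e ∈ E.carrier, ∀ᵐ t ∂μ, 0 < e t := by
  obtain ⟨ν, hν, hμν, hνμ⟩ := exists_isFiniteMeasure_absolutelyContinuous μ
  set s : (Ω →ₘ[μ] ℝ) → ℝ≥0∞ := fun x => ν {t | x t ≠ 0} with hs
  set T := sSup (s '' E.carrier) with hT
  obtain ⟨u, -, hu, hmem⟩ := exists_seq_tendsto_sSup (S := s '' E.carrier) ⟨_, 0, hE.zero_mem, rfl⟩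
    (OrderTop.bddAbove _)
  choose x hx hxu using hmem
  -- Normalize the sequence so that it is bounded, without changing the supports.
  set c : ℕ → ℝ≥0 := fun n => ((E.norm (x n)).toNNReal + 1)⁻¹ with hc
  have hc0 : ∀ n, 0 < c n := fun n => by positivity
  obtain ⟨F, hF, hFle⟩ := hE.exists_majorant (fun n => (c n : ℝ) • x n)
    (fun n => hE.smul_mem _ _ (hx n)) 1 (fun n => by
      refine (hE.norm_smul_le (hx n) (c n)
        (ENNReal.coe_toNNReal (hE.norm_ne_top _ (hx n))).ge).trans ?_
      rw [← ENNReal.coe_mul, ENNReal.coe_le_coe, hc]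
      rw [inv_mul_le_iff₀ (by positivity)]; simp)
  have hxF : ∀ n, s (x n) ≤ s F := by
    intro n
    refine measure_mono_ae ?_
    change ∀ᵐ t ∂ν, t ∈ {t | x n t ≠ 0} → t ∈ {t | F t ≠ 0}
    refine hνμ.ae_le ?_
    filter_upwards [hFle n, AEEqFun.coeFn_smul (c n : ℝ) (x n)] with t h1 h2 h3
    rw [h2, Pi.smul_apply, smul_eq_mul] at h1
    intro h0
    have h3' : x n t ≠ 0 := h3
    have h0' : F t = 0 := h0
    have : (0 : ℝ) < (2⁻¹ : ℝ) ^ n * |(c n : ℝ) * x n t| := by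
      have := (hc0 n).ne'
      positivity
    rw [h0', abs_zero] at h1
    linarith
  have hTF : T ≤ s F := le_of_tendsto' hu fun n => by rw [← hxu n]; exact hxF n
  refine ⟨|F|, (hE.abs_mem hF).1, ?_⟩
  suffices h : ∀ᵐ t ∂μ, F t ≠ 0 by
    filter_upwards [h, AEEqFun.coeFn_abs F] with t h1 h2
    rw [h2]; exact abs_pos.2 h1
  by_contra hne
  have hAm : MeasurableSet {t | F t = 0} := F.measurable (measurableSet_singleton 0)
  have hApos : 0 < μ {t | F t = 0} := by
    rw [pos_iff_ne_zero]
    intro h0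
    exact hne (by simpa [ae_iff] using h0)
  obtain ⟨y, hy, hyA⟩ := hsupp _ hAm hApos
  -- The support of `|F| + |y|` is larger than that of `F` by a set of positive measure.
  have hsum := hE.add_mem _ (hE.abs_mem hF).1 _ (hE.abs_mem hy).1
  have hBm : MeasurableSet {t | F t = 0 ∧ y t ≠ 0} :=
    hAm.inter (y.measurable (measurableSet_singleton 0).compl)
  have hBpos : ν {t | F t = 0 ∧ y t ≠ 0} ≠ 0 := by
    intro h0
    refine hyA ?_
    have := hμν h0
    rw [measure_eq_zero_iff_ae_notMem] at this
    filter_upwards [this] with t ht hA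
    by_contra hyt
    exact ht ⟨hA, hyt⟩
  have hge : s F + ν {t | F t = 0 ∧ y t ≠ 0} ≤ s (|F| + |y|) := by
    rw [hs]
    simp only
    rw [← measure_union _ hBm]
    · refine measure_mono_ae ?_
      change ∀ᵐ t ∂ν, t ∈ {t | F t ≠ 0} ∪ {t | F t = 0 ∧ y t ≠ 0} → t ∈ {t | (|F| + |y|) t ≠ 0}
      refine hνμ.ae_le ?_
      filter_upwards [AEEqFun.coeFn_add |F| |y|, AEEqFun.coeFn_abs F, AEEqFun.coeFn_abs y]
        with t h1 h2 h3 h4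
      rw [h1, Pi.add_apply, h2, h3]
      rcases h4 with h4 | h4
      · have h4' : F t ≠ 0 := h4
        positivity
      · have h4' : y t ≠ 0 := h4.2
        positivity
    · rw [Set.disjoint_left]
      exact fun t h1 h2 => h1 h2.1
  have hle : s F + ν {t | F t = 0 ∧ y t ≠ 0} ≤ s F + 0 := by
    rw [add_zero]
    exact hge.trans ((le_sSup (mem_image_of_mem s hsum)).trans hTF)
  exact hBpos (le_antisymm ((ENNReal.add_le_add_iff_left (measure_ne_top ν _)).1 hle) bot_le)

theorem exists_weak_unit_norm_le [SigmaFinite μ] (hE : E.IsBanachIdealSpace)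
    (hsupp : E.HasFullSupport) {δ : ℝ≥0} (hδ : 0 < δ) :
    ∃ e ∈ E.carrier, E.norm e ≤ δ ∧ ∀ᵐ t ∂μ, 0 < e t := by
  obtain ⟨e, he, hpos⟩ := hE.exists_weak_unit hsupp
  set c : ℝ≥0 := δ / ((E.norm e).toNNReal + 1) with hc
  refine ⟨(c : ℝ) • e, hE.smul_mem _ _ he, ?_, ?_⟩
  · refine (hE.norm_smul_le he c (ENNReal.coe_toNNReal (hE.norm_ne_top _ he)).ge).trans ?_
    rw [← ENNReal.coe_mul, ENNReal.coe_le_coe, hc, div_mul_eq_mul_div, div_le_iff₀ (by positivity)]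
    gcongr; simp
  · filter_upwards [hpos, AEEqFun.coeFn_smul (c : ℝ) e] with t h1 h2
    rw [h2]
    have : (0 : ℝ) < c := by positivity
    exact mul_pos this h1

/-- If the truncations `min w (n e)` of a function `w` with values in `[0, ∞]` stay in a ball of a
Banach ideal space with the Fatou property, `e` being a weak unit, then `w` is finite almost
everywhere and belongs to the ball. -/
theorem exists_eq_of_truncations (hE : E.IsBanachIdealSpace) (hFatou : E.HasFatouProperty)
    {e : Ω →ₘ[μ] ℝ} (he : e ∈ E.carrier) (hpos : ∀ᵐ t ∂μ, 0 < e t) {w : Ω → ℝ≥0∞}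
    (hw : Measurable w) (v : ℕ → Ω →ₘ[μ] ℝ)
    (hv : ∀ n : ℕ, ∀ᵐ t ∂μ, v n t = (min (w t) (ENNReal.ofReal (n * e t))).toReal)
    {r : ℝ≥0} (hr : ∀ n, v n ∈ E.carrier ∧ E.norm (v n) ≤ r) :
    ∃ f ∈ E.carrier, E.norm f ≤ r ∧ ∀ᵐ t ∂μ, w t = ‖f t‖₊ := by
  have hv' := ae_all_iff.2 hv
  have hfin : ∀ᵐ t ∂μ, w t ≠ ∞ := by
    have hAm : MeasurableSet {t | w t = ∞} := hw (measurableSet_singleton _)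
    set d : Ω →ₘ[μ] ℝ := AEEqFun.mk (indicator {t | w t = ∞} e)
      (e.stronglyMeasurable.indicator hAm).aestronglyMeasurable with hd
    have hdae : d =ᵐ[μ] indicator {t | w t = ∞} e := AEEqFun.coeFn_mk _ _
    have hdmem : d ∈ E.carrier := by
      refine (hE.of_abs_le he ?_).1
      filter_upwards [hdae] with t h1
      rw [h1, indicator]
      split_ifs <;> simp
    have hdle : ∀ n : ℕ, E.norm d ≤ ((((n : ℝ≥0) + 1)⁻¹ * r : ℝ≥0) : ℝ≥0∞) := by
      intro n
      have hle : ∀ᵐ t ∂μ, |d t| ≤ |((((n : ℝ≥0) + 1)⁻¹ : ℝ≥0) • v (n + 1)) t| := by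
        filter_upwards [hdae, hv (n + 1), hpos,
          AEEqFun.coeFn_smul (((n : ℝ≥0) + 1)⁻¹ : ℝ≥0) (v (n + 1))] with t h1 h2 h3 h4
        rw [h1, h4, Pi.smul_apply, h2, indicator]
        split_ifs with h5
        · have h5' : w t = ∞ := h5
          rw [h5', min_eq_right le_top, ENNReal.toReal_ofReal (by positivity), NNReal.smul_def]
          refine le_of_eq (congrArg _ ?_)
          push_cast
          rw [smul_eq_mul, inv_mul_cancel_left₀ (by positivity)]
        · simp
      refine (hE.of_abs_le (hE.smul_mem _ _ (hr (n + 1)).1) hle).2.trans ?_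
      rw [ENNReal.coe_mul]
      exact hE.norm_smul_le (hr (n + 1)).1 _ (hr (n + 1)).2
    have hlim : Tendsto (fun n : ℕ => ((((n : ℝ≥0) + 1)⁻¹ * r : ℝ≥0) : ℝ≥0∞)) atTop (𝓝 0) := by
      rw [← ENNReal.coe_zero, ENNReal.tendsto_coe]
      have : Tendsto (fun n : ℕ => ((n : ℝ≥0) + 1)⁻¹) atTop (𝓝 0) :=
        tendsto_inv_atTop_zero.comp
          (tendsto_atTop_mono (fun n => le_self_add) tendsto_natCast_atTop_atTop)
      simpa using this.mul_const r
    have h0 := hE.eq_zero_of_forall_norm_le hdmem hlim (Eventually.of_forall hdle)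
    have h0' : (d : Ω → ℝ) =ᵐ[μ] 0 := by rw [h0]; exact AEEqFun.coeFn_zero
    filter_upwards [h0', hdae, hpos] with t h1 h2 h3 h4
    rw [h1, indicator_of_mem (by exact h4)] at h2
    exact h3.ne h2
  set f : Ω →ₘ[μ] ℝ := AEEqFun.mk (fun t => (w t).toReal)
    hw.ennreal_toReal.aestronglyMeasurable with hf
  have hfae : f =ᵐ[μ] fun t => (w t).toReal := AEEqFun.coeFn_mk _ _
  have hsup : (⨆ n, E.norm (v n)) ≤ r := iSup_le fun n => (hr n).2
  obtain ⟨hfm, hflim⟩ := hFatou v f (fun n => (hr n).1) (by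
    filter_upwards [hv', hfin, hpos, hfae] with t h1 h2 h3 h4
    refine ⟨fun n => by rw [h1 n]; exact ENNReal.toReal_nonneg, fun m n hmn => ?_, ?_⟩
    · simp only [h1]
      refine ENNReal.toReal_mono (by simp [h2]) ?_
      gcongr
    · have hev : ∀ᶠ n : ℕ in atTop, (w t).toReal ≤ n * e t :=
        (tendsto_natCast_atTop_atTop.atTop_mul_const h3).eventually_ge_atTop _
      refine tendsto_const_nhds.congr' ?_
      filter_upwards [hev] with n hn
      rw [h1 n, h4, min_eq_left ((ENNReal.le_ofReal_iff_toReal_le h2 (by positivity)).2 hn)])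
    (hsup.trans_lt ENNReal.coe_lt_top)
  refine ⟨f, hfm, le_of_tendsto' hflim fun n => (hr n).2, ?_⟩
  filter_upwards [hfae, hfin] with t h1 h2
  rw [h1]
  simp only [Real.nnnorm_of_nonneg ENNReal.toReal_nonneg]
  exact (ENNReal.coe_toNNReal h2).symm

end IsBanachIdealSpace

end FunctionSpace

/-! ### Balls of Calderón–Lozanovskiĭ spaces -/

namespace FunctionSpace

/-- `|x| ≤ l φ⁻¹(|f|)` almost everywhere for some `f ∈ E` with `‖f‖ ≤ r`. For `r = 1` this describes
the multiple by `l` of the unit ball of `E_φ` without mentioning `φ`, which may take the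
value `∞`. -/
def InBall (E : FunctionSpace μ) (φ : YoungFunction) (r l : ℝ≥0) (x : Ω →ₘ[μ] ℝ) : Prop :=
  ∃ f ∈ E.carrier, E.norm f ≤ r ∧ ∀ᵐ t ∂μ, ‖x t‖₊ ≤ l * φ.inv ‖f t‖₊

variable {E : FunctionSpace μ} {φ : YoungFunction} {r l : ℝ≥0} {x : Ω →ₘ[μ] ℝ}

theorem InBall.mono (h : InBall E φ r l x) {y : Ω →ₘ[μ] ℝ} {l' : ℝ≥0} (hl : l ≤ l')
    (hy : ∀ᵐ t ∂μ, ‖y t‖₊ ≤ ‖x t‖₊) : InBall E φ r l' y := by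
  obtain ⟨f, hf, hfr, hx⟩ := h
  refine ⟨f, hf, hfr, ?_⟩
  filter_upwards [hx, hy] with t h1 h2
  exact h2.trans (h1.trans (by gcongr))

theorem InBall.mono_right (h : InBall E φ r l x) {l' : ℝ≥0} (hl : l ≤ l') :
    InBall E φ r l' x :=
  h.mono hl (Eventually.of_forall fun _ => le_rfl)

theorem InBall.smul (h : InBall E φ r l x) (c : ℝ) : InBall E φ r (‖c‖₊ * l) (c • x) := by
  obtain ⟨f, hf, hfr, hx⟩ := h
  refine ⟨f, hf, hfr, ?_⟩
  filter_upwards [hx, AEEqFun.coeFn_smul c x] with t h1 h2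
  rw [h2, Pi.smul_apply, smul_eq_mul, nnnorm_mul, mul_assoc]
  gcongr

/-- By concavity of `φ⁻¹`, the radius `r` can be changed at the expense of a factor. -/
theorem InBall.rescale (hE : E.IsBanachIdealSpace) (h : InBall E φ r l x) {s : ℝ≥0} (hs : 0 < s) :
    InBall E φ s (max 1 (r / s) * l) x := by
  obtain ⟨f, hf, hfr, hx⟩ := h
  set k : ℝ≥0 := max 1 (r / s) with hk
  have hk1 : 1 ≤ k := le_max_left _ _
  have hk0 : 0 < k := zero_lt_one.trans_le hk1
  refine ⟨((k⁻¹ : ℝ≥0) : ℝ) • f, hE.smul_mem _ _ hf, ?_, ?_⟩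
  · refine (hE.norm_smul_le hf _ hfr).trans ?_
    rw [← ENNReal.coe_mul, ENNReal.coe_le_coe, inv_mul_le_iff₀ hk0, ← div_le_iff₀ hs]
    exact le_max_right _ _
  · filter_upwards [hx, AEEqFun.coeFn_smul ((k⁻¹ : ℝ≥0) : ℝ) f] with t h1 h2
    rw [h2, Pi.smul_apply, smul_eq_mul, nnnorm_mul]
    have h3 := φ.inv_mul_le hk1 (k⁻¹ * ‖f t‖₊)
    rw [mul_inv_cancel_left₀ hk0.ne'] at h3
    have h4 : ‖((k⁻¹ : ℝ≥0) : ℝ)‖₊ = k⁻¹ := by simp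
    rw [h4]
    calc ‖x t‖₊ ≤ l * φ.inv ‖f t‖₊ := h1
      _ ≤ l * (k * φ.inv (k⁻¹ * ‖f t‖₊)) := by gcongr
      _ = k * l * φ.inv (k⁻¹ * ‖f t‖₊) := by ring

theorem modular_le_iff (hE : E.IsBanachIdealSpace) :
    E.modular φ x ≤ r ↔ InBall E φ r 1 x := by
  have hcomp : φ.compAbs x =ᵐ[μ] fun t => (φ.toFun ‖x t‖₊).toReal :=
    AEEqFun.coeFn_compMeasurable _ _ x
  constructor
  · intro h
    rw [modular] at h
    split_ifs at h with hc
    · refine ⟨_, hc.2, h, ?_⟩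
      filter_upwards [hc.1, hcomp] with t h1 h2
      rw [one_mul, h2]
      refine φ.toFun_le_iff.1 ?_
      rw [Real.nnnorm_of_nonneg ENNReal.toReal_nonneg]
      exact (ENNReal.coe_toNNReal h1.ne).ge
    · simp at h
  · rintro ⟨f, hf, hfr, hx⟩
    have hle : ∀ᵐ t ∂μ, φ.toFun ‖x t‖₊ ≤ ‖f t‖₊ := by
      filter_upwards [hx] with t h1
      exact φ.toFun_le_iff.2 (by simpa using h1)
    have hmem := hE.of_abs_le (x := φ.compAbs x) hf (by
      filter_upwards [hle, hcomp] with t h1 h2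
      rw [h2, abs_of_nonneg ENNReal.toReal_nonneg]
      exact ENNReal.toReal_mono ENNReal.coe_ne_top h1)
    have hfin : ∀ᵐ t ∂μ, φ.toFun ‖x t‖₊ < ∞ := by
      filter_upwards [hle] with t h1 using h1.trans_lt ENNReal.coe_lt_top
    rw [modular, if_pos ⟨hfin, hmem.1⟩]
    exact hmem.2.trans hfr

theorem modular_inv_smul_le_iff (hE : E.IsBanachIdealSpace) (hl : 0 < l) :
    E.modular φ ((l : ℝ)⁻¹ • x) ≤ r ↔ InBall E φ r l x := by
  have hl' : (l : ℝ) ≠ 0 := by exact_mod_cast hl.ne'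
  rw [modular_le_iff hE]
  constructor
  · intro h
    have := h.smul (l : ℝ)
    rw [smul_inv_smul₀ hl'] at this
    simpa using this
  · intro h
    have := h.smul (l : ℝ)⁻¹
    refine this.mono_right (le_of_eq ?_)
    simp [inv_mul_cancel₀ hl.ne']

theorem calderonLozanovskii_norm_le (hE : E.IsBanachIdealSpace) (h : InBall E φ 1 l x) :
    (E.calderonLozanovskii φ).norm x ≤ l := by
  have hpos : ∀ l' : ℝ≥0, l < l' → (E.calderonLozanovskii φ).norm x ≤ l' := fun l' hl' =>
    iInf₂_le l' ⟨hl'.pos, by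
      simpa using (modular_inv_smul_le_iff (r := 1) hE hl'.pos).2 (h.mono_right hl'.le)⟩
  refine le_of_forall_gt_imp_ge_of_dense fun c hc => ?_
  induction c with
  | top => exact le_top
  | coe c => exact hpos c (by exact_mod_cast hc)

theorem inBall_of_norm_lt (hE : E.IsBanachIdealSpace)
    (h : (E.calderonLozanovskii φ).norm x < l) : InBall E φ 1 l x := by
  simp only [calderonLozanovskii, iInf_lt_iff] at h
  obtain ⟨l', ⟨hl', hm⟩, hlt⟩ := h
  exact ((modular_inv_smul_le_iff hE hl').1 (by simpa using hm)).mono_right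
    (by exact_mod_cast hlt.le)

theorem mem_calderonLozanovskii_iff (hE : E.IsBanachIdealSpace) :
    x ∈ (E.calderonLozanovskii φ).carrier ↔ ∃ l, InBall E φ 1 l x := by
  constructor
  · rintro ⟨c, hc, hm⟩
    lift c to ℝ≥0 using hc.le
    have hc' : 0 < c⁻¹ := inv_pos.2 (by exact_mod_cast hc)
    obtain ⟨r, hr⟩ := ENNReal.lt_iff_exists_coe.1 hm
    have := (modular_inv_smul_le_iff (x := x) (φ := φ) (r := r) hE hc').1 (by simp [hr.1])
    exact ⟨_, this.rescale hE one_pos⟩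
  · rintro ⟨l, h⟩
    have hl : 0 < l + 1 := by positivity
    refine ⟨((l + 1 : ℝ≥0) : ℝ)⁻¹, by positivity, ?_⟩
    exact ((modular_inv_smul_le_iff hE hl).2 (h.mono_right le_self_add)).trans_lt
      ENNReal.coe_lt_top

theorem InBall.mem_calderonLozanovskii (hE : E.IsBanachIdealSpace) (h : InBall E φ r l x) :
    x ∈ (E.calderonLozanovskii φ).carrier :=
  (mem_calderonLozanovskii_iff hE).2 ⟨_, h.rescale hE one_pos⟩

theorem calderonLozanovskii_norm_le_of_inBall (hE : E.IsBanachIdealSpace)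
    (h : InBall E φ r l x) : (E.calderonLozanovskii φ).norm x ≤ (max 1 r * l : ℝ≥0) := by
  simpa using calderonLozanovskii_norm_le hE (h.rescale hE one_pos)

theorem inBall_of_norm_lt' (hE : E.IsBanachIdealSpace) (hr : 0 < r)
    (h : (E.calderonLozanovskii φ).norm x < l) : InBall E φ r (max 1 r⁻¹ * l) x := by
  simpa using (inBall_of_norm_lt hE h).rescale hE hr

/-! ### Homogeneous functionals and spaces of multipliers -/

theorem aeEqFun_smul_mul (c : ℝ) (x y : Ω →ₘ[μ] ℝ) : c • x * y = c • (x * y) := by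
  refine AEEqFun.ext ?_
  filter_upwards [AEEqFun.coeFn_mul (c • x) y, AEEqFun.coeFn_smul c x, AEEqFun.coeFn_mul x y,
    AEEqFun.coeFn_smul c (x * y)] with t h1 h2 h3 h4
  simp [h1, h2, h3, h4, mul_assoc]

theorem aeEqFun_mul_smul (c : ℝ) (x y : Ω →ₘ[μ] ℝ) : x * c • y = c • (x * y) := by
  rw [mul_comm, aeEqFun_smul_mul, mul_comm]

/-- The laws of a normed space without the triangle inequality. -/
structure NormLike (X : FunctionSpace μ) : Prop where
  smul_mem : ∀ (c : ℝ), ∀ x ∈ X.carrier, c • x ∈ X.carrier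
  norm_smul_le : ∀ (c : ℝ), ∀ x ∈ X.carrier, X.norm (c • x) ≤ ‖c‖₊ * X.norm x
  norm_ne_top : ∀ x ∈ X.carrier, X.norm x ≠ ∞
  eq_zero_of_norm : ∀ x ∈ X.carrier, X.norm x = 0 → x = 0

theorem NormLike.exists_unit {X : FunctionSpace μ} (hX : X.NormLike) {y : Ω →ₘ[μ] ℝ}
    (hy : y ∈ X.carrier) (h0 : X.norm y ≠ 0) :
    ∃ y' ∈ X.carrier, X.norm y' = 1 ∧ y = ((X.norm y).toNNReal : ℝ) • y' := by
  have htop := hX.norm_ne_top y hy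
  set c := (X.norm y).toNNReal with hc
  have hcy : X.norm y = c := (ENNReal.coe_toNNReal htop).symm
  have hc0 : c ≠ 0 := by
    intro h
    rw [h] at hcy
    exact h0 (by simpa using hcy)
  have hcR : (c : ℝ) ≠ 0 := by exact_mod_cast hc0
  have hback : y = (c : ℝ) • ((c : ℝ)⁻¹ • y) := (smul_inv_smul₀ hcR y).symm
  have hmem := hX.smul_mem (c : ℝ)⁻¹ y hy
  refine ⟨_, hmem, le_antisymm ?_ ?_, hback⟩
  · refine (hX.norm_smul_le _ y hy).trans ?_
    rw [hcy, ← ENNReal.coe_mul]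
    simp [inv_mul_cancel₀ hc0]
  · have h1 := hX.norm_smul_le (c : ℝ) _ hmem
    rw [← hback, hcy, NNReal.nnnorm_eq] at h1
    have hcE : (c : ℝ≥0∞) ≠ 0 := by exact_mod_cast hc0
    rw [← ENNReal.mul_le_mul_iff_right hcE ENNReal.coe_ne_top, mul_one]
    exact h1

theorem norm_mul_le_of_multipliers {X Y : FunctionSpace μ} (hX : X.NormLike) (hY : Y.NormLike)
    {z y : Ω →ₘ[μ] ℝ} (hz : z ∈ (multipliers X Y).carrier)
    (hy : y ∈ X.carrier) : Y.norm (z * y) ≤ (multipliers X Y).norm z * X.norm y := by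
  rcases eq_or_ne (X.norm y) 0 with h0 | h0
  · have hy0 : y = (0 : ℝ) • y := by rw [zero_smul, hX.eq_zero_of_norm y hy h0]
    rw [hy0, aeEqFun_mul_smul]
    refine (hY.norm_smul_le 0 _ (hz y hy)).trans ?_
    simp
  · obtain ⟨y', hy', h1, hyy'⟩ := hX.exists_unit hy h0
    have h2 : Y.norm (z * y') ≤ (multipliers X Y).norm z :=
      le_iSup₂_of_le y' hy' (le_iSup_of_le h1 le_rfl)
    have h3 : z * y = ((X.norm y).toNNReal : ℝ) • (z * y') := by
      conv_lhs => rw [hyy']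
      rw [aeEqFun_mul_smul]
    rw [h3]
    refine (hY.norm_smul_le _ _ (hz y' hy')).trans ?_
    rw [NNReal.nnnorm_eq, ENNReal.coe_toNNReal (hX.norm_ne_top y hy), mul_comm]
    gcongr

theorem EqWithEquivNorms.of_le {X Y : FunctionSpace μ} (hc : X.carrier = Y.carrier) {C D : ℝ≥0}
    (hC : ∀ x ∈ X.carrier, X.norm x ≤ C * Y.norm x)
    (hD : ∀ x ∈ X.carrier, Y.norm x ≤ D * X.norm x) : EqWithEquivNorms X Y := by
  have hC1 : C + 1 ≠ 0 := by positivity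
  refine ⟨hc, (C + 1)⁻¹, D + 1, by positivity, by positivity, fun x hx => ⟨?_, ?_⟩⟩
  · rw [ENNReal.coe_inv hC1,
      ENNReal.inv_mul_le_iff (by exact_mod_cast hC1) ENNReal.coe_ne_top]
    exact (hC x hx).trans (by gcongr; simp)
  · exact (hD x hx).trans (by gcongr; simp)

theorem EqWithEquivNorms.exists_le {X Y : FunctionSpace μ} (h : EqWithEquivNorms X Y) :
    ∃ C D : ℝ≥0, (∀ x ∈ X.carrier, X.norm x ≤ C * Y.norm x) ∧
      ∀ x ∈ X.carrier, Y.norm x ≤ D * X.norm x := by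
  obtain ⟨-, c, D, hc0, -, hn⟩ := h
  refine ⟨c⁻¹, D, fun x hx => ?_, fun x hx => (hn x hx).2⟩
  rw [ENNReal.coe_inv hc0.ne', ← ENNReal.div_eq_inv_mul,
    ENNReal.le_div_iff_mul_le (Or.inl (by exact_mod_cast hc0.ne')) (Or.inl ENNReal.coe_ne_top),
    mul_comm]
  exact (hn x hx).1

theorem EqWithEquivNorms.trans {X Y Z : FunctionSpace μ} (h : EqWithEquivNorms X Y)
    (h' : EqWithEquivNorms Y Z) : EqWithEquivNorms X Z := by
  obtain ⟨hc, c, C, hc0, hC0, hn⟩ := h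
  obtain ⟨hc', c', C', hc0', hC0', hn'⟩ := h'
  refine ⟨hc.trans hc', c' * c, C' * C, by positivity, by positivity, fun x hx => ?_⟩
  obtain ⟨h1, h2⟩ := hn x hx
  obtain ⟨h1', h2'⟩ := hn' x (hc ▸ hx)
  rw [ENNReal.coe_mul, ENNReal.coe_mul, mul_assoc, mul_assoc]
  exact ⟨le_trans (by gcongr) h1', h2'.trans (by gcongr)⟩

theorem multipliers_norm_smul_le {X Y : FunctionSpace μ} (hY : Y.NormLike) (c : ℝ)
    {z : Ω →ₘ[μ] ℝ} (hz : z ∈ (multipliers X Y).carrier) :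
    (multipliers X Y).norm (c • z) ≤ ‖c‖₊ * (multipliers X Y).norm z := by
  refine iSup₂_le fun y hy => iSup_le fun h1 => ?_
  rw [aeEqFun_smul_mul]
  refine (hY.norm_smul_le c _ (hz y hy)).trans ?_
  gcongr
  exact le_iSup₂_of_le y hy (le_iSup_of_le h1 le_rfl)

theorem NormLike.multipliers {X Y Z : FunctionSpace μ} (hY : Y.NormLike) (hZ : Z.NormLike)
    (h : EqWithEquivNorms (multipliers X Y) Z) : (multipliers X Y).NormLike := by
  obtain ⟨hc, c, C, hc0, hC0, hn⟩ := h
  have hcE : (c : ℝ≥0∞) ≠ 0 := by exact_mod_cast hc0.ne'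
  refine ⟨fun a z hz y hy => ?_, fun a z hz => multipliers_norm_smul_le hY a hz,
    fun z hz htop => ?_, fun z hz h0 => ?_⟩
  · rw [aeEqFun_smul_mul]
    exact hY.smul_mem a _ (hz y hy)
  · have h1 := (hn z hz).1
    rw [htop, ENNReal.mul_top hcE, top_le_iff] at h1
    exact hZ.norm_ne_top z (hc ▸ hz) h1
  · have h2 := (hn z hz).2
    rw [h0, mul_zero, nonpos_iff_eq_zero] at h2
    exact hZ.eq_zero_of_norm z (hc ▸ hz) h2

theorem multipliers_norm_le_of_norm_le {X X' Y : FunctionSpace μ} (hX : X.NormLike)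
    (hY : Y.NormLike) (hc : X.carrier = X'.carrier) {C : ℝ≥0}
    (hn : ∀ x ∈ X.carrier, X.norm x ≤ C * X'.norm x) {z : Ω →ₘ[μ] ℝ}
    (hz : z ∈ (multipliers X Y).carrier) :
    (multipliers X' Y).norm z ≤ C * (multipliers X Y).norm z := by
  refine iSup₂_le fun y hy => iSup_le fun h1 => ?_
  have hy' : y ∈ X.carrier := hc ▸ hy
  refine (norm_mul_le_of_multipliers hX hY hz hy').trans ?_
  have := hn y hy'
  rw [h1, mul_one] at this
  rw [mul_comm]
  gcongr

theorem EqWithEquivNorms.multipliers_left {X X' Y : FunctionSpace μ} (hX : X.NormLike)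
    (hX' : X'.NormLike) (hY : Y.NormLike) (h : EqWithEquivNorms X X') :
    EqWithEquivNorms (multipliers X Y) (multipliers X' Y) := by
  obtain ⟨C, D, hC, hD⟩ := h.exists_le
  have hc := h.1
  have hcm : (multipliers X Y).carrier = (multipliers X' Y).carrier := by
    simp only [multipliers, hc]
  exact EqWithEquivNorms.of_le hcm
    (fun z hz => multipliers_norm_le_of_norm_le hX' hY hc.symm (fun x hx => hD x (hc ▸ hx))
      (hcm ▸ hz))
    (fun z hz => multipliers_norm_le_of_norm_le hX hY hc hC hz)

/-! ### The Luxemburg–Nakano norm -/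

theorem calderonLozanovskii_norm_smul_le (hE : E.IsBanachIdealSpace) (c : ℝ)
    (hx : (E.calderonLozanovskii φ).norm x ≠ ∞) :
    (E.calderonLozanovskii φ).norm (c • x) ≤ ‖c‖₊ * (E.calderonLozanovskii φ).norm x :=
  ennreal_le_mul_of_forall_gt hx fun l hl => by
    simpa using calderonLozanovskii_norm_le hE ((inBall_of_norm_lt hE hl).smul c)

/-- Since `φ⁻¹` grows at most linearly, an element of norm zero of `E_φ` vanishes: for every
`δ > 0` the function `(|x| - δ)⁺` has arbitrarily small norm in `E`. -/
theorem eq_zero_of_calderonLozanovskii_norm (hE : E.IsBanachIdealSpace)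
    (hx : (E.calderonLozanovskii φ).norm x = 0) : x = 0 := by
  obtain ⟨a, b, hab⟩ := φ.exists_inv_le
  have key : ∀ k : ℕ, ∀ᵐ t ∂μ, |x t| ≤ ((k : ℝ) + 1)⁻¹ := by
    intro k
    set δ : ℝ := ((k : ℝ) + 1)⁻¹ with hδ
    have hδ0 : 0 < δ := by positivity
    have hm : Measurable fun r : ℝ => max (|r| - δ) 0 := by fun_prop
    set h : Ω →ₘ[μ] ℝ := AEEqFun.compMeasurable (fun r : ℝ => max (|r| - δ) 0) hm x with hh
    have hae : h =ᵐ[μ] fun t => max (|x t| - δ) 0 := AEEqFun.coeFn_compMeasurable _ _ x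
    have hle : ∀ l : ℝ≥0, 0 < l → (l : ℝ) * a ≤ δ →
        h ∈ E.carrier ∧ E.norm h ≤ ((l * b : ℝ≥0) : ℝ≥0∞) := by
      intro l hl hla
      obtain ⟨f, hf, hf1, hxf⟩ := inBall_of_norm_lt (φ := φ) (x := x) (l := l) hE (by
        rw [hx]; exact_mod_cast hl)
      have hdom : ∀ᵐ t ∂μ, |h t| ≤ |(((l * b : ℝ≥0) : ℝ) • f) t| := by
        filter_upwards [hae, hxf, AEEqFun.coeFn_smul ((l * b : ℝ≥0) : ℝ) f] with t h1 h2 h3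
        rw [h1, h3, Pi.smul_apply, smul_eq_mul, abs_mul, NNReal.abs_eq,
          abs_of_nonneg (le_max_right _ _)]
        have h4 : ‖x t‖₊ ≤ l * (a + b * ‖f t‖₊) := h2.trans (by gcongr; exact hab _)
        have h5 : |x t| ≤ l * (a + b * |f t|) := by exact_mod_cast h4
        refine max_le ?_ (by positivity)
        push_cast
        nlinarith
      obtain ⟨h1, h2⟩ := hE.of_abs_le (hE.smul_mem _ _ hf) hdom
      refine ⟨h1, h2.trans ?_⟩
      simpa using hE.norm_smul_le hf (l * b) hf1
    have hδn : ∀ n : ℕ, 0 < Real.toNNReal δ / ((a + 1) * (n + 1)) := fun n => by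
      have : 0 < Real.toNNReal δ := Real.toNNReal_pos.2 hδ0
      positivity
    have hδa : ∀ n : ℕ, ((Real.toNNReal δ / ((a + 1) * (n + 1)) : ℝ≥0) : ℝ) * a ≤ δ := by
      intro n
      push_cast
      rw [Real.coe_toNNReal _ hδ0.le, div_mul_eq_mul_div, div_le_iff₀ (by positivity)]
      gcongr
      nlinarith [a.2, (Nat.cast_nonneg n : (0 : ℝ) ≤ n), mul_nonneg a.2 (Nat.cast_nonneg n)]
    have hlim : Tendsto (fun n : ℕ => ((Real.toNNReal δ / ((a + 1) * (n + 1)) * b : ℝ≥0) : ℝ≥0∞))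
        atTop (𝓝 0) := by
      rw [← ENNReal.coe_zero, ENNReal.tendsto_coe]
      have h1 : Tendsto (fun n : ℕ => ((n : ℝ≥0) + 1)⁻¹) atTop (𝓝 0) :=
        tendsto_inv_atTop_zero.comp
          (tendsto_atTop_mono (fun n => le_self_add) tendsto_natCast_atTop_atTop)
      have h2 := (h1.const_mul (Real.toNNReal δ / (a + 1))).mul_const b
      simp only [mul_zero, zero_mul] at h2
      refine h2.congr fun n => ?_
      rw [div_mul_eq_div_div, div_eq_mul_inv (Real.toNNReal δ / (a + 1))]
    have h0 := hE.eq_zero_of_forall_norm_le (hle _ (hδn 0) (hδa 0)).1 hlim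
      (Eventually.of_forall fun n => (hle _ (hδn n) (hδa n)).2)
    have h0' : (h : Ω → ℝ) =ᵐ[μ] 0 := by rw [h0]; exact AEEqFun.coeFn_zero
    filter_upwards [h0', hae] with t h1 h2
    rw [h1, Pi.zero_apply] at h2
    have := le_max_left (|x t| - δ) 0
    linarith
  refine AEEqFun.ext ?_
  filter_upwards [ae_all_iff.2 key, (AEEqFun.coeFn_zero : ⇑(0 : Ω →ₘ[μ] ℝ) =ᵐ[μ] 0)] with t h1 h2
  rw [h2, Pi.zero_apply, ← abs_nonpos_iff]
  exact ge_of_tendsto' (by simpa using tendsto_one_div_add_atTop_nhds_zero_nat (𝕜 := ℝ)) h1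

theorem normLike_calderonLozanovskii (hE : E.IsBanachIdealSpace) (φ : YoungFunction) :
    (E.calderonLozanovskii φ).NormLike := by
  have htop : ∀ x ∈ (E.calderonLozanovskii φ).carrier, (E.calderonLozanovskii φ).norm x ≠ ∞ := by
    intro x hx
    obtain ⟨l, hl⟩ := (mem_calderonLozanovskii_iff hE).1 hx
    exact ((calderonLozanovskii_norm_le hE hl).trans_lt ENNReal.coe_lt_top).ne
  refine ⟨fun c x hx => ?_, fun c x hx => calderonLozanovskii_norm_smul_le hE c (htop x hx), htop,
    fun x _ h0 => eq_zero_of_calderonLozanovskii_norm hE h0⟩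
  obtain ⟨l, hl⟩ := (mem_calderonLozanovskii_iff hE).1 hx
  exact (hl.smul c).mem_calderonLozanovskii hE

end FunctionSpace

/-! ### The equivalence of inverses along elements of the space -/

namespace FunctionSpace

/-- The common form of the three alternatives: `φ₁⁻¹ φ₂⁻¹` and `φ⁻¹` are equivalent along every
element of the ball of radius `ε` of `E` that dominates the weak unit `e`. The norm of `e` is small
enough, compared to `ε`, for `e` to be added to elements of balls of radius a fraction of `ε`. -/
structure InvEquivAlong (E : FunctionSpace μ) (φ₁ φ₂ φ : YoungFunction) (e : Ω →ₘ[μ] ℝ)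
    (ε C D : ℝ≥0) : Prop where
  pos : 0 < ε
  pos_left : 0 < C
  pos_right : 0 < D
  mem : e ∈ E.carrier
  norm_le : E.norm e ≤ (ε / 4 : ℝ≥0)
  unit_pos : ∀ᵐ t ∂μ, 0 < e t
  equiv : ∀ f ∈ E.carrier, E.norm f ≤ ε → (∀ᵐ t ∂μ, e t ≤ |f t|) → ∀ᵐ t ∂μ,
    C * (φ₁.inv ‖f t‖₊ * φ₂.inv ‖f t‖₊) ≤ φ.inv ‖f t‖₊ ∧
      φ.inv ‖f t‖₊ ≤ D * (φ₁.inv ‖f t‖₊ * φ₂.inv ‖f t‖₊)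

variable {E : FunctionSpace μ} {φ φ₁ φ₂ : YoungFunction} {e : Ω →ₘ[μ] ℝ} {ε C D : ℝ≥0}

theorem InvEquivAlong.swap (h : InvEquivAlong E φ₁ φ₂ φ e ε C D) :
    InvEquivAlong E φ₂ φ₁ φ e ε C D :=
  { h with
    equiv := fun f hf hfε hef => by
      filter_upwards [h.equiv f hf hfε hef] with t ht
      rwa [mul_comm (φ₂.inv _)] }

theorem exists_invEquivAlong [SigmaFinite μ] (hE : E.IsBanachIdealSpace)
    (hsupp : E.HasFullSupport)
    (h : YoungFunction.InvEquivAll φ₁ φ₂ φ ∨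
      (YoungFunction.InvEquivLarge φ₁ φ₂ φ ∧ (linfty μ).Embeds E) ∨
      (YoungFunction.InvEquivSmall φ₁ φ₂ φ ∧ E.Embeds (linfty μ))) :
    ∃ e ε C D, InvEquivAlong E φ₁ φ₂ φ e ε C D := by
  rcases h with ⟨C, D, hC, hD, h⟩ | ⟨⟨u₀, hu₀, C, D, hC, hD, h⟩, hemb, -⟩ |
    ⟨⟨u₀, hu₀, C, D, hC, hD, h⟩, hemb, K, hK⟩
  · obtain ⟨e, he, hen, hpos⟩ := hE.exists_weak_unit_norm_le hsupp (δ := 1 / 4) (by positivity)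
    refine ⟨e, 1, C, D, one_pos, hC, hD, he, hen, hpos, fun f _ _ hef => ?_⟩
    filter_upwards [hpos, hef] with t h1 h2
    exact h _ (nnnorm_pos.2 (abs_pos.1 (h1.trans_le h2)))
  · -- Here the weak unit is the constant `u₀`.
    have hae : (AEEqFun.const Ω (u₀ : ℝ) : Ω →ₘ[μ] ℝ) =ᵐ[μ] fun _ => (u₀ : ℝ) :=
      AEEqFun.coeFn_const _ _
    have he : (AEEqFun.const Ω (u₀ : ℝ) : Ω →ₘ[μ] ℝ) ∈ E.carrier := by
      refine hemb ?_
      change eLpNorm _ ∞ μ < ∞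
      rw [eLpNorm_congr_ae hae]
      exact (memLp_top_const (u₀ : ℝ)).2
    set N := (E.norm (AEEqFun.const Ω (u₀ : ℝ) : Ω →ₘ[μ] ℝ)).toNNReal with hN
    refine ⟨_, 4 * (N + 1), C, D, by positivity, hC, hD, he, ?_, ?_, fun f _ _ hef => ?_⟩
    · rw [mul_div_cancel_left₀ _ four_ne_zero]
      refine (ENNReal.coe_toNNReal (hE.norm_ne_top _ he)).ge.trans ?_
      rw [← hN]
      exact_mod_cast le_self_add
    · filter_upwards [hae] with t h1
      rw [h1]; exact_mod_cast hu₀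
    · filter_upwards [hae, hef] with t h1 h2
      rw [h1] at h2
      exact h _ (by exact_mod_cast h2)
  · -- Here the radius is so small that the elements of the ball are bounded by `u₀`.
    set ε : ℝ≥0 := u₀ / (K + 1) with hε
    have hε0 : 0 < ε := by positivity
    obtain ⟨e, he, hen, hpos⟩ := hE.exists_weak_unit_norm_le hsupp (δ := ε / 4) (by positivity)
    refine ⟨e, ε, C, D, hε0, hC, hD, he, hen, hpos, fun f hf hfε hef => ?_⟩
    have hbound : eLpNorm f ∞ μ ≤ u₀ := by
      refine (hK f hf).trans ?_
      calc (K : ℝ≥0∞) * E.norm f ≤ K * ε := by gcongr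
        _ ≤ u₀ := by
          rw [← ENNReal.coe_mul, ENNReal.coe_le_coe, hε, mul_div_assoc',
            div_le_iff₀ (by positivity), mul_comm]
          gcongr; simp
    rw [eLpNorm_exponent_top] at hbound
    filter_upwards [hpos, hef, ae_le_eLpNormEssSup (f := f) (μ := μ)] with t h1 h2 h3
    exact h _ ⟨nnnorm_pos.2 (abs_pos.1 (h1.trans_le h2)), by exact_mod_cast h3.trans hbound⟩

/-! ### The product of two Calderón–Lozanovskiĭ spaces -/

theorem InvEquivAlong.inBall_mul (hE : E.IsBanachIdealSpace)
    (h : InvEquivAlong E φ₁ φ₂ φ e ε C D) {x₁ x₂ : Ω →ₘ[μ] ℝ} {l₁ l₂ : ℝ≥0}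
    (h₁ : InBall E φ₁ (ε / 4) l₁ x₁) (h₂ : InBall E φ₂ (ε / 4) l₂ x₂) :
    InBall E φ ε (C⁻¹ * l₁ * l₂) (x₁ * x₂) := by
  obtain ⟨f₁, hf₁, hn₁, hx₁⟩ := h₁
  obtain ⟨f₂, hf₂, hn₂, hx₂⟩ := h₂
  have ha₁ := hE.abs_mem hf₁
  have ha₂ := hE.abs_mem hf₂
  have hs := hE.add_mem _ ha₁.1 _ ha₂.1
  set f := |f₁| + |f₂| + e with hf
  have hfm : f ∈ E.carrier := hE.add_mem _ hs _ h.mem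
  have hfn : E.norm f ≤ ε := by
    refine (hE.norm_add_le _ hs _ h.mem).trans ?_
    calc _ ≤ E.norm |f₁| + E.norm |f₂| + E.norm e := by
          gcongr; exact hE.norm_add_le _ ha₁.1 _ ha₂.1
      _ ≤ ((ε / 4 : ℝ≥0) : ℝ≥0∞) + ((ε / 4 : ℝ≥0) : ℝ≥0∞) + ((ε / 4 : ℝ≥0) : ℝ≥0∞) :=
          add_le_add (add_le_add (ha₁.2.trans hn₁) (ha₂.2.trans hn₂)) h.norm_le
      _ ≤ ε := by
          rw [← ENNReal.coe_add, ← ENNReal.coe_add, ENNReal.coe_le_coe, ← NNReal.coe_le_coe]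
          push_cast
          linarith [NNReal.coe_nonneg ε]
  have hfae : ∀ᵐ t ∂μ, f t = |f₁ t| + |f₂ t| + e t := by
    filter_upwards [AEEqFun.coeFn_add (|f₁| + |f₂|) e, AEEqFun.coeFn_add |f₁| |f₂|,
      AEEqFun.coeFn_abs f₁, AEEqFun.coeFn_abs f₂] with t h1 h2 h3 h4
    rw [hf, h1, Pi.add_apply, h2, Pi.add_apply, h3, h4]
  refine ⟨f, hfm, hfn, ?_⟩
  filter_upwards [hfae, h.unit_pos, hx₁, hx₂, AEEqFun.coeFn_mul x₁ x₂,
    h.equiv f hfm hfn (by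
      filter_upwards [hfae] with t h1
      refine le_trans ?_ (le_abs_self _)
      rw [h1]; linarith [abs_nonneg (f₁ t), abs_nonneg (f₂ t)])] with t h1 h2 h3 h4 h5 h6
  have hle₁ : ‖f₁ t‖₊ ≤ ‖f t‖₊ := by
    rw [← NNReal.coe_le_coe, coe_nnnorm, coe_nnnorm, Real.norm_eq_abs, Real.norm_eq_abs, h1]
    refine le_trans ?_ (le_abs_self _)
    linarith [abs_nonneg (f₂ t)]
  have hle₂ : ‖f₂ t‖₊ ≤ ‖f t‖₊ := by
    rw [← NNReal.coe_le_coe, coe_nnnorm, coe_nnnorm, Real.norm_eq_abs, Real.norm_eq_abs, h1]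
    refine le_trans ?_ (le_abs_self _)
    linarith [abs_nonneg (f₁ t)]
  rw [h5, Pi.mul_apply, nnnorm_mul]
  calc ‖x₁ t‖₊ * ‖x₂ t‖₊ ≤ (l₁ * φ₁.inv ‖f t‖₊) * (l₂ * φ₂.inv ‖f t‖₊) := by
        gcongr
        · exact h3.trans (by gcongr; exact φ₁.inv_mono hle₁)
        · exact h4.trans (by gcongr; exact φ₂.inv_mono hle₂)
    _ = C⁻¹ * l₁ * l₂ * (C * (φ₁.inv ‖f t‖₊ * φ₂.inv ‖f t‖₊)) := by
        have := h.pos_left.ne'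
        field_simp
    _ ≤ _ := by gcongr; exact h6.1

theorem InvEquivAlong.exists_norm_mul_le (hE : E.IsBanachIdealSpace)
    (h : InvEquivAlong E φ₁ φ₂ φ e ε C D) :
    ∃ A : ℝ≥0, ∀ x₁ ∈ (E.calderonLozanovskii φ₁).carrier,
      ∀ x₂ ∈ (E.calderonLozanovskii φ₂).carrier, x₁ * x₂ ∈ (E.calderonLozanovskii φ).carrier ∧
        (E.calderonLozanovskii φ).norm (x₁ * x₂) ≤
          A * ((E.calderonLozanovskii φ₁).norm x₁ * (E.calderonLozanovskii φ₂).norm x₂) := by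
  have hε : 0 < ε / 4 := div_pos h.pos four_pos
  set k : ℝ≥0 := max 1 (ε / 4)⁻¹ with hk
  refine ⟨max 1 ε * (C⁻¹ * k * k), fun x₁ hx₁ x₂ hx₂ => ?_⟩
  have ht₁ := (normLike_calderonLozanovskii hE φ₁).norm_ne_top x₁ hx₁
  have ht₂ := (normLike_calderonLozanovskii hE φ₂).norm_ne_top x₂ hx₂
  have key : ∀ l₁ l₂ : ℝ≥0, (E.calderonLozanovskii φ₁).norm x₁ < l₁ →
      (E.calderonLozanovskii φ₂).norm x₂ < l₂ →
      InBall E φ ε (C⁻¹ * (k * l₁) * (k * l₂)) (x₁ * x₂) := fun l₁ l₂ h₁ h₂ =>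
    h.inBall_mul hE (inBall_of_norm_lt' hE hε h₁) (inBall_of_norm_lt' hE hε h₂)
  constructor
  · obtain ⟨l₁, h₁, -⟩ := ENNReal.lt_iff_exists_nnreal_btwn.1 (lt_top_iff_ne_top.2 ht₁)
    obtain ⟨l₂, h₂, -⟩ := ENNReal.lt_iff_exists_nnreal_btwn.1 (lt_top_iff_ne_top.2 ht₂)
    exact (key l₁ l₂ h₁ h₂).mem_calderonLozanovskii hE
  · set n₂ := (E.calderonLozanovskii φ₂).norm x₂ with hn₂
    lift n₂ to ℝ≥0 using ht₂ with m hm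
    have h1 : ∀ l₁ : ℝ≥0, (E.calderonLozanovskii φ₁).norm x₁ < l₁ →
        (E.calderonLozanovskii φ).norm (x₁ * x₂) ≤
          ((max 1 ε * (C⁻¹ * k * k) * m : ℝ≥0) : ℝ≥0∞) * l₁ := by
      intro l₁ h₁
      refine (ennreal_le_mul_of_forall_gt (a := m) (k := max 1 ε * (C⁻¹ * k * k) * l₁)
        ENNReal.coe_ne_top fun l₂ h₂ => ?_).trans (le_of_eq ?_)
      · refine (calderonLozanovskii_norm_le_of_inBall hE
          (key l₁ l₂ h₁ h₂)).trans (le_of_eq ?_)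
        rw [← ENNReal.coe_mul]
        congr 1; ring
      · rw [← ENNReal.coe_mul, ← ENNReal.coe_mul]
        congr 1; ring
    refine (ennreal_le_mul_of_forall_gt ht₁ h1).trans (le_of_eq ?_)
    push_cast; ring

/-- The factorization `z = x₁ x₂` with `x₁ = φ₁⁻¹(|f|)`, where `|z| ≤ l φ⁻¹(|f|)`. -/
theorem InvEquivAlong.exists_factorization (hE : E.IsBanachIdealSpace)
    (h : InvEquivAlong E φ₁ φ₂ φ e ε C D) {z : Ω →ₘ[μ] ℝ} {l : ℝ≥0}
    (hz : InBall E φ (ε / 4) l z) :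
    ∃ x₁ x₂ : Ω →ₘ[μ] ℝ, InBall E φ₁ ε 1 x₁ ∧ InBall E φ₂ ε (l * D) x₂ ∧ z = x₁ * x₂ := by
  obtain ⟨f₀, hf₀, hn₀, hz⟩ := hz
  have ha₀ := hE.abs_mem hf₀
  set f := |f₀| + e with hf
  have hfm : f ∈ E.carrier := hE.add_mem _ ha₀.1 _ h.mem
  have hfn : E.norm f ≤ ε := by
    refine (hE.norm_add_le _ ha₀.1 _ h.mem).trans ?_
    calc _ ≤ ((ε / 4 : ℝ≥0) : ℝ≥0∞) + ((ε / 4 : ℝ≥0) : ℝ≥0∞) :=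
          add_le_add (ha₀.2.trans hn₀) h.norm_le
      _ ≤ ε := by
          rw [← ENNReal.coe_add, ENNReal.coe_le_coe, ← NNReal.coe_le_coe]
          push_cast
          linarith [NNReal.coe_nonneg ε]
  have hfae : ∀ᵐ t ∂μ, f t = |f₀ t| + e t := by
    filter_upwards [AEEqFun.coeFn_add |f₀| e, AEEqFun.coeFn_abs f₀] with t h1 h2
    rw [hf, h1, Pi.add_apply, h2]
  have hequiv := h.equiv f hfm hfn (by
    filter_upwards [hfae] with t h1
    refine le_trans ?_ (le_abs_self _)
    rw [h1]; linarith [abs_nonneg (f₀ t)])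
  set x₁ : Ω →ₘ[μ] ℝ := AEEqFun.compMeasurable (fun r : ℝ => (φ₁.inv ‖r‖₊ : ℝ))
    φ₁.measurable_inv f with hx₁
  have hx₁ae : x₁ =ᵐ[μ] fun t => (φ₁.inv ‖f t‖₊ : ℝ) := AEEqFun.coeFn_compMeasurable _ _ f
  have hdiv : Measurable (Function.uncurry fun a b : ℝ => a / b) :=
    measurable_fst.div measurable_snd
  set x₂ : Ω →ₘ[μ] ℝ := AEEqFun.comp₂Measurable (fun a b : ℝ => a / b) hdiv z x₁ with hx₂
  have hx₂ae : x₂ =ᵐ[μ] fun t => z t / x₁ t := AEEqFun.coeFn_comp₂Measurable _ _ z x₁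
  have hpos : ∀ᵐ t ∂μ, 0 < φ₁.inv ‖f t‖₊ := by
    filter_upwards [hfae, h.unit_pos] with t h1 h2
    refine φ₁.inv_pos (nnnorm_pos.2 ?_)
    rw [h1]; positivity
  refine ⟨x₁, x₂, ⟨f, hfm, hfn, ?_⟩, ⟨f, hfm, hfn, ?_⟩, AEEqFun.ext ?_⟩
  · filter_upwards [hx₁ae] with t h1
    rw [h1]; simp
  · filter_upwards [hx₁ae, hx₂ae, hpos, hequiv, hz, hfae, h.unit_pos] with t h1 h2 h3 h4 h5 h6 h7
    have hle : ‖f₀ t‖₊ ≤ ‖f t‖₊ := by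
      rw [← NNReal.coe_le_coe, coe_nnnorm, coe_nnnorm, Real.norm_eq_abs, Real.norm_eq_abs, h6]
      refine le_trans ?_ (le_abs_self _)
      linarith
    rw [h2, h1, nnnorm_div, NNReal.nnnorm_eq, div_le_iff₀ h3]
    calc ‖z t‖₊ ≤ l * φ.inv ‖f t‖₊ := h5.trans (by gcongr; exact φ.inv_mono hle)
      _ ≤ l * (D * (φ₁.inv ‖f t‖₊ * φ₂.inv ‖f t‖₊)) := by gcongr; exact h4.2
      _ = l * D * φ₂.inv ‖f t‖₊ * φ₁.inv ‖f t‖₊ := by ring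
  · filter_upwards [hx₁ae, hx₂ae, hpos, AEEqFun.coeFn_mul x₁ x₂] with t h1 h2 h3 h4
    have h3' : x₁ t ≠ 0 := by rw [h1]; exact_mod_cast h3.ne'
    rw [h4, Pi.mul_apply, h2, mul_div_cancel₀ _ h3']

/-! ### The multipliers from one Calderón–Lozanovskiĭ space to another -/

/-- A multiplier is bounded. Otherwise there are `yₙ ≤ φ₁⁻¹(|fₙ|)`, with bounded `fₙ ∈ E`, on which
multiplication by `z` is larger than `4ⁿ`; but `yₙ ≤ 2ⁿ φ₁⁻¹(F)` for a common majorant `F ∈ E` of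
the functions `2⁻ⁿ |fₙ|`. -/
theorem exists_inBall_mul_of_mem_multipliers (hE : E.IsBanachIdealSpace) {z : Ω →ₘ[μ] ℝ}
    (hz : z ∈ (multipliers (E.calderonLozanovskii φ₁) (E.calderonLozanovskii φ)).carrier)
    {r s : ℝ≥0} (hs : 0 < s) :
    ∃ K : ℝ≥0, ∀ y, InBall E φ₁ r 1 y → InBall E φ s K (z * y) := by
  by_contra! hcon
  choose y hy hny using fun n : ℕ => hcon (4 ^ n)
  choose f hf hfn hyf using hy
  obtain ⟨F, hF, hFle⟩ := hE.exists_majorant f hf r hfn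
  set Y : Ω →ₘ[μ] ℝ := AEEqFun.compMeasurable (fun r : ℝ => (φ₁.inv ‖r‖₊ : ℝ))
    φ₁.measurable_inv F with hY
  have hYae : Y =ᵐ[μ] fun t => (φ₁.inv ‖F t‖₊ : ℝ) := AEEqFun.coeFn_compMeasurable _ _ F
  have hYball : InBall E φ₁ (E.norm F).toNNReal 1 Y := by
    refine ⟨F, hF, (ENNReal.coe_toNNReal (hE.norm_ne_top F hF)).ge, ?_⟩
    filter_upwards [hYae] with t h1
    rw [h1]; simp
  obtain ⟨L, hL⟩ := (mem_calderonLozanovskii_iff hE).1 (hz Y (hYball.mem_calderonLozanovskii hE))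
  have hL' := hL.rescale hE hs
  set L' := max 1 (1 / s) * L
  obtain ⟨n, hn⟩ := pow_unbounded_of_one_lt L' (one_lt_two : (1 : ℝ≥0) < 2)
  refine hny n (((hL'.smul ((2 : ℝ) ^ n))).mono ?_ ?_)
  · have : ‖(2 : ℝ) ^ n‖₊ = 2 ^ n := by simp
    rw [this]
    calc (2 : ℝ≥0) ^ n * L' ≤ 2 ^ n * 2 ^ n := by gcongr
      _ = 4 ^ n := by rw [← mul_pow]; norm_num
  · filter_upwards [hYae, hyf n, hFle n, AEEqFun.coeFn_mul z Y, AEEqFun.coeFn_mul z (y n),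
      AEEqFun.coeFn_smul ((2 : ℝ) ^ n) (z * Y)] with t h1 h2 h3 h4 h5 h6
    rw [h6, Pi.smul_apply, h4, h5, Pi.mul_apply, Pi.mul_apply, h1, smul_eq_mul, nnnorm_mul,
      nnnorm_mul, nnnorm_mul, NNReal.nnnorm_eq, mul_left_comm]
    have h7 : ‖(2 : ℝ) ^ n‖₊ = 2 ^ n := by simp
    have h8 : ‖f n t‖₊ ≤ 2 ^ n * ‖F t‖₊ := by
      rw [← NNReal.coe_le_coe]
      push_cast
      rwa [Real.norm_eq_abs, Real.norm_eq_abs, ← inv_mul_le_iff₀ (by positivity), ← inv_pow]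
    rw [h7]
    gcongr
    calc ‖y n t‖₊ ≤ 1 * φ₁.inv ‖f n t‖₊ := h2
      _ ≤ φ₁.inv (2 ^ n * ‖F t‖₊) := by rw [one_mul]; exact φ₁.inv_mono h8
      _ ≤ 2 ^ n * φ₁.inv ‖F t‖₊ := φ₁.inv_mul_le (one_le_pow₀ one_le_two) _

/-- If `z / l` is outside a ball of `E_φ`, then there is `v ∈ E` outside the corresponding ball of
`E`, but of controlled norm, such that `φ⁻¹(v) ≤ 2 |z| / l` where `v > 0`: a multiple of a
truncation of `φ(|z| / l)`. The factor `2` allows for the points at which `φ⁻¹(φ(u)) > u`. -/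
theorem exists_inv_le_of_not_inBall (hE : E.IsBanachIdealSpace) (hFatou : E.HasFatouProperty)
    (he : e ∈ E.carrier) (hpos : ∀ᵐ t ∂μ, 0 < e t) {r R l : ℝ≥0} (hrR : r < R) (hl : 0 < l)
    {z : Ω →ₘ[μ] ℝ} (hz : ¬ InBall E φ r l z) :
    ∃ v ∈ E.carrier, r < E.norm v ∧ E.norm v ≤ R ∧
      ∀ᵐ t ∂μ, 0 ≤ v t ∧ (v t ≠ 0 → l * φ.inv ‖v t‖₊ ≤ 2 * ‖z t‖₊) := by
  set w : Ω → ℝ≥0∞ := fun t => φ.toFun (l⁻¹ * ‖z t‖₊) with hw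
  have hwm : Measurable w := φ.mono.measurable.comp (z.measurable.nnnorm.const_mul _)
  set v : ℕ → Ω →ₘ[μ] ℝ := fun n => AEEqFun.mk
    (fun t => (min (w t) (ENNReal.ofReal (n * e t))).toReal)
    (hwm.min (e.measurable.const_mul _).ennreal_ofReal).ennreal_toReal.aestronglyMeasurable with hv
  have hvae : ∀ n : ℕ, ∀ᵐ t ∂μ, v n t = (min (w t) (ENNReal.ofReal (n * e t))).toReal :=
    fun n => AEEqFun.coeFn_mk _ _
  have hvmem : ∀ n, v n ∈ E.carrier := by
    intro n
    refine (hE.of_abs_le (hE.smul_mem (n : ℝ) _ he) ?_).1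
    filter_upwards [hvae n, AEEqFun.coeFn_smul (n : ℝ) e, hpos] with t h1 h2 h3
    rw [h1, h2, Pi.smul_apply, smul_eq_mul, abs_of_nonneg ENNReal.toReal_nonneg,
      abs_of_nonneg (by positivity)]
    exact ENNReal.toReal_le_of_le_ofReal (by positivity) (min_le_right _ _)
  obtain ⟨n, hn⟩ : ∃ n, r < E.norm (v n) := by
    by_contra! hcon
    obtain ⟨f, hf, hfr, hwf⟩ := hE.exists_eq_of_truncations hFatou he hpos hwm v hvae
      fun n => ⟨hvmem n, hcon n⟩
    refine hz ⟨f, hf, hfr, ?_⟩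
    filter_upwards [hwf] with t h1
    have h2 : l⁻¹ * ‖z t‖₊ ≤ φ.inv ‖f t‖₊ := φ.toFun_le_iff.1 h1.le
    rwa [inv_mul_le_iff₀ hl] at h2
  -- Scale `v n` down to norm at most `R`.
  set N := (E.norm (v n)).toNNReal with hN
  have hNn : E.norm (v n) = N := (ENNReal.coe_toNNReal (hE.norm_ne_top _ (hvmem n))).symm
  rw [hNn, ENNReal.coe_lt_coe] at hn
  have hN0 : 0 < N := hn.pos
  set c : ℝ≥0 := min 1 (R / N) with hc
  have hc1 : c ≤ 1 := min_le_left _ _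
  have hcn : E.norm ((c : ℝ) • v n) = ((c * N : ℝ≥0) : ℝ≥0∞) := by
    rw [hE.norm_smul _ _ (hvmem n), NNReal.abs_eq, ENNReal.ofReal_coe_nnreal, hNn, ENNReal.coe_mul]
  refine ⟨(c : ℝ) • v n, hE.smul_mem _ _ (hvmem n), ?_, ?_, ?_⟩
  · rw [hcn, ENNReal.coe_lt_coe]
    rcases min_choice 1 (R / N) with h | h
    · rw [hc, h, one_mul]; exact hn
    · rw [hc, h, div_mul_cancel₀ _ hN0.ne']; exact hrR
  · rw [hcn, ENNReal.coe_le_coe, ← le_div_iff₀ hN0]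
    exact min_le_right _ _
  · filter_upwards [hvae n, AEEqFun.coeFn_smul (c : ℝ) (v n)] with t h1 h2
    rw [h2, Pi.smul_apply, smul_eq_mul]
    have h3 : 0 ≤ v n t := by rw [h1]; exact ENNReal.toReal_nonneg
    refine ⟨by positivity, fun h4 => ?_⟩
    set p : ℝ≥0 := ‖c * v n t‖₊ with hp
    have hp0 : 0 < p := nnnorm_pos.2 h4
    have hpw : (p : ℝ≥0∞) ≤ w t := by
      have h5 : (p : ℝ≥0∞) ≤ (‖v n t‖₊ : ℝ≥0∞) := by
        rw [hp, nnnorm_mul, NNReal.nnnorm_eq, ENNReal.coe_le_coe]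
        exact mul_le_of_le_one_left bot_le hc1
      refine h5.trans ?_
      rw [h1, Real.nnnorm_of_nonneg ENNReal.toReal_nonneg]
      change ((min (w t) (ENNReal.ofReal (n * e t))).toNNReal : ℝ≥0∞) ≤ w t
      exact ENNReal.coe_toNNReal_le_self.trans (min_le_left _ _)
    have h6 : φ.inv (2⁻¹ * p) ≤ l⁻¹ * ‖z t‖₊ := by
      refine φ.inv_le_of_lt (lt_of_lt_of_le ?_ hpw)
      rw [ENNReal.coe_lt_coe]
      exact mul_lt_of_lt_one_left hp0 (by norm_num)
    have h7 := φ.inv_mul_le one_le_two (2⁻¹ * p)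
    rw [mul_inv_cancel_left₀ two_ne_zero] at h7
    calc l * φ.inv p ≤ l * (2 * (l⁻¹ * ‖z t‖₊)) := by gcongr; exact h7.trans (by gcongr)
      _ = 2 * ‖z t‖₊ := by field_simp

/-- The key estimate. If `z / l` is outside a ball of `E_φ₂`, test `z` on `y = φ₁⁻¹(v)`, where
`v ∈ E` is such that `l φ₂⁻¹(v) ≤ 2 |z|`. Then `l φ⁻¹(v) ≤ 2 D |z y|`, so that `z y` has a large
norm in `E_φ`. -/
theorem InvEquivAlong.inBall_of_forall_mul (hE : E.IsBanachIdealSpace)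
    (hFatou : E.HasFatouProperty) (h : InvEquivAlong E φ₁ φ₂ φ e ε C D) {z : Ω →ₘ[μ] ℝ} {K l : ℝ≥0}
    (hK : ∀ y, InBall E φ₁ ε 1 y → InBall E φ (ε / 4) K (z * y)) (hl : 2 * D * K < l) :
    InBall E φ₂ (ε / 2) l z := by
  by_contra hz
  have hl0 : 0 < l := hl.pos
  have hε := h.pos
  obtain ⟨v, hv, hvlow, hvup, hvz⟩ := exists_inv_le_of_not_inBall hE hFatou h.mem h.unit_pos
    (r := ε / 2) (R := 3 * ε / 4) (by
      rw [← NNReal.coe_lt_coe]; push_cast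
      have : (0 : ℝ) < ε := hε
      linarith) hl0 hz
  -- The part of `v` that dominates `e` carries most of its norm.
  set A : Set Ω := {t | e t ≤ v t} with hA
  have hAm : MeasurableSet A := measurableSet_le e.measurable v.measurable
  set v' : Ω →ₘ[μ] ℝ := AEEqFun.mk (A.indicator v)
    (v.stronglyMeasurable.indicator hAm).aestronglyMeasurable with hv'
  have hv'ae : v' =ᵐ[μ] A.indicator v := AEEqFun.coeFn_mk _ _
  have hv'mem := hE.of_abs_le (x := v') hv (by
    filter_upwards [hv'ae] with t h1
    rw [h1, indicator]; split_ifs <;> simp)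
  have hv'low : ¬ E.norm v' ≤ (ε / 4 : ℝ≥0) := by
    intro hle
    have hs := hE.add_mem _ hv'mem.1 _ h.mem
    have h1 := (hE.of_abs_le (x := v) hs (by
      filter_upwards [hv'ae, AEEqFun.coeFn_add v' e, hvz, h.unit_pos] with t h1 h2 h3 h4
      rw [h2, Pi.add_apply, h1, abs_of_nonneg h3.1]
      refine le_trans ?_ (le_abs_self _)
      rw [indicator]
      split_ifs with h5
      · linarith
      · have h5' : ¬ e t ≤ v t := h5
        linarith)).2
    have h2 : E.norm v ≤ ((ε / 4 : ℝ≥0) : ℝ≥0∞) + ((ε / 4 : ℝ≥0) : ℝ≥0∞) :=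
      h1.trans ((hE.norm_add_le _ hv'mem.1 _ h.mem).trans (add_le_add hle h.norm_le))
    have h3 : ((ε / 2 : ℝ≥0) : ℝ≥0∞) < ((ε / 4 + ε / 4 : ℝ≥0) : ℝ≥0∞) := by
      rw [ENNReal.coe_add]; exact hvlow.trans_le h2
    rw [ENNReal.coe_lt_coe, ← NNReal.coe_lt_coe] at h3
    push_cast at h3
    linarith
  -- On that part the equivalence of inverses holds along `v`.
  have hequiv : ∀ᵐ t ∂μ, t ∈ A → φ.inv ‖v t‖₊ ≤ D * (φ₁.inv ‖v t‖₊ * φ₂.inv ‖v t‖₊) := by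
    have hmax : ∀ᵐ t ∂μ, (v ⊔ e) t = max (v t) (e t) := AEEqFun.coeFn_sup v e
    have hs := hE.add_mem _ hv _ h.mem
    have hm := hE.of_abs_le (x := v ⊔ e) hs (by
      filter_upwards [hmax, AEEqFun.coeFn_add v e, hvz, h.unit_pos] with t h1 h2 h3 h4
      rw [h1, h2, Pi.add_apply, abs_of_nonneg (h4.le.trans (le_max_right _ _)),
        abs_of_nonneg (add_nonneg h3.1 h4.le)]
      exact max_le (by linarith) (by linarith [h3.1]))
    have hn : E.norm (v ⊔ e) ≤ ε := by
      refine hm.2.trans ((hE.norm_add_le _ hv _ h.mem).trans ((add_le_add hvup h.norm_le).trans ?_))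
      rw [← ENNReal.coe_add, ENNReal.coe_le_coe, ← NNReal.coe_le_coe]
      push_cast
      linarith
    filter_upwards [hmax, h.equiv _ hm.1 hn (by
      filter_upwards [hmax] with t h1
      rw [h1]; exact (le_max_right _ _).trans (le_abs_self _))] with t h1 h2 h3
    have h3' : e t ≤ v t := h3
    rw [h1, max_eq_left h3'] at h2
    exact h2.2
  set y : Ω →ₘ[μ] ℝ := AEEqFun.mk (A.indicator fun t => (φ₁.inv ‖v t‖₊ : ℝ))
    ((φ₁.measurable_inv.comp v.measurable).indicator hAm).aestronglyMeasurable with hy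
  have hyae : y =ᵐ[μ] A.indicator fun t => (φ₁.inv ‖v t‖₊ : ℝ) := AEEqFun.coeFn_mk _ _
  have hvε : E.norm v ≤ ε := by
    refine hvup.trans ?_
    rw [ENNReal.coe_le_coe, ← NNReal.coe_le_coe]
    push_cast
    linarith [NNReal.coe_nonneg ε]
  obtain ⟨f, hf, hfn, hzy⟩ := hK y ⟨v, hv, hvε, by
    filter_upwards [hyae] with t h1
    rw [h1, indicator]; split_ifs <;> simp⟩
  -- Comparing `φ⁻¹(v)` and `φ⁻¹(f)` shows that `f` dominates that part of `v`.
  refine hv'low ((hE.of_abs_le hf ?_).2.trans hfn)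
  filter_upwards [hv'ae, hequiv, hyae, hzy, hvz, h.unit_pos, AEEqFun.coeFn_mul z y]
    with t h1 h2 h3 h4 h5 h6 h7
  rw [h1]
  by_cases ht : t ∈ A
  · rw [indicator_of_mem ht]
    rw [h7, Pi.mul_apply, h3, indicator_of_mem ht, nnnorm_mul, NNReal.nnnorm_eq] at h4
    have hvt : 0 < v t := h6.trans_le ht
    have h8 := h2 ht
    have h9 := h5.2 hvt.ne'
    have h10 : 0 < φ.inv ‖v t‖₊ := φ.inv_pos (nnnorm_pos.2 hvt.ne')
    have h11 : l * φ.inv ‖v t‖₊ ≤ 2 * D * K * φ.inv ‖f t‖₊ := by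
      calc l * φ.inv ‖v t‖₊ ≤ l * (D * (φ₁.inv ‖v t‖₊ * φ₂.inv ‖v t‖₊)) := by gcongr
        _ = D * φ₁.inv ‖v t‖₊ * (l * φ₂.inv ‖v t‖₊) := by ring
        _ ≤ D * φ₁.inv ‖v t‖₊ * (2 * ‖z t‖₊) := by gcongr
        _ = 2 * D * (‖z t‖₊ * φ₁.inv ‖v t‖₊) := by ring
        _ ≤ 2 * D * (K * φ.inv ‖f t‖₊) := by gcongr
        _ = _ := by ring
    by_contra! hlt
    have h12 : φ.inv ‖f t‖₊ ≤ φ.inv ‖v t‖₊ := φ.inv_mono (by exact_mod_cast hlt.le)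
    have h13 : l * φ.inv ‖v t‖₊ ≤ 2 * D * K * φ.inv ‖v t‖₊ := h11.trans (by gcongr)
    exact absurd (le_of_mul_le_mul_right h13 h10) (not_le.2 hl)
  · rw [indicator_of_notMem ht]; simp

/-- `M(E_φ₁, E_φ) = E_φ₂` with equivalent norms. -/
theorem InvEquivAlong.multipliers_eq (hE : E.IsBanachIdealSpace) (hFatou : E.HasFatouProperty)
    (h : InvEquivAlong E φ₁ φ₂ φ e ε C D) :
    EqWithEquivNorms (multipliers (E.calderonLozanovskii φ₁) (E.calderonLozanovskii φ))
      (E.calderonLozanovskii φ₂) := by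
  obtain ⟨A, hA⟩ := h.exists_norm_mul_le hE
  have hε4 : 0 < ε / 4 := div_pos h.pos four_pos
  have hsub : ∀ z ∈ (multipliers (E.calderonLozanovskii φ₁) (E.calderonLozanovskii φ)).carrier,
      z ∈ (E.calderonLozanovskii φ₂).carrier := by
    intro z hz
    obtain ⟨K, hK⟩ := exists_inBall_mul_of_mem_multipliers hE hz hε4
    exact (h.inBall_of_forall_mul hE hFatou hK (lt_add_one _)).mem_calderonLozanovskii hE
  refine EqWithEquivNorms.of_le (C := A)
    (D := max 1 (ε / 2) * (2 * D * (max 1 (ε / 4)⁻¹ * max 1 ε)))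
    (Subset.antisymm hsub fun z hz y hy => ?_) (fun z hz => ?_) (fun z hz => ?_)
  · rw [mul_comm]; exact (hA y hy z hz).1
  · refine iSup₂_le fun y hy => iSup_le fun h1 => ?_
    have := (hA y hy z (hsub z hz)).2
    rwa [h1, one_mul, mul_comm y] at this
  · set m := (multipliers (E.calderonLozanovskii φ₁) (E.calderonLozanovskii φ)).norm z with hm
    rcases eq_or_ne m ∞ with htop | htop
    · rw [htop, ENNReal.mul_top]
      · exact le_top
      · have h1 : (0 : ℝ≥0) < max 1 (ε / 2) := lt_of_lt_of_le one_pos (le_max_left _ _)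
        have h2 : (0 : ℝ≥0) < max 1 (ε / 4)⁻¹ := lt_of_lt_of_le one_pos (le_max_left _ _)
        have h3 : (0 : ℝ≥0) < max 1 ε := lt_of_lt_of_le one_pos (le_max_left _ _)
        have h4 := h.pos_right
        exact ENNReal.coe_ne_zero.2 (by positivity)
    · refine ennreal_le_mul_of_forall_gt htop fun k hk => ?_
      have hnorm : ∀ y, InBall E φ₁ ε 1 y →
          InBall E φ (ε / 4) (max 1 (ε / 4)⁻¹ * (max 1 ε * k)) (z * y) := by
        intro y hy
        refine inBall_of_norm_lt' hE hε4 ?_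
        have hy1 : (E.calderonLozanovskii φ₁).norm y ≤ (max 1 ε : ℝ≥0) := by
          simpa using calderonLozanovskii_norm_le_of_inBall hE hy
        have hε1 : ((max 1 ε : ℝ≥0) : ℝ≥0∞) ≠ 0 :=
          ENNReal.coe_ne_zero.2 (lt_of_lt_of_le one_pos (le_max_left _ _)).ne'
        calc _ ≤ m * (E.calderonLozanovskii φ₁).norm y :=
              norm_mul_le_of_multipliers (normLike_calderonLozanovskii hE φ₁)
                (normLike_calderonLozanovskii hE φ) hz (hy.mem_calderonLozanovskii hE)
          _ ≤ m * (max 1 ε : ℝ≥0) := by gcongr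
          _ < k * (max 1 ε : ℝ≥0) := (ENNReal.mul_lt_mul_iff_left hε1 ENNReal.coe_ne_top).2 hk
          _ = ((max 1 ε * k : ℝ≥0) : ℝ≥0∞) := by rw [mul_comm, ENNReal.coe_mul]
      have hl : ∀ l : ℝ≥0, ((2 * D * (max 1 (ε / 4)⁻¹ * (max 1 ε * k)) : ℝ≥0) : ℝ≥0∞) < l →
          (E.calderonLozanovskii φ₂).norm z ≤ (max 1 (ε / 2) : ℝ≥0) * (l : ℝ≥0∞) := by
        intro l hl
        rw [← ENNReal.coe_mul]
        exact calderonLozanovskii_norm_le_of_inBall hE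
          (h.inBall_of_forall_mul hE hFatou hnorm (ENNReal.coe_lt_coe.1 hl))
      refine (ennreal_le_mul_of_forall_gt ENNReal.coe_ne_top hl).trans (le_of_eq ?_)
      rw [← ENNReal.coe_mul, ← ENNReal.coe_mul]
      congr 1; ring

/-- `E_φ₁ ⊙ M(E_φ₁, E_φ) = E_φ` with equivalent norms, by identifying the multipliers with
`E_φ₂`. -/
theorem InvEquivAlong.prod_multipliers_eq (hE : E.IsBanachIdealSpace)
    (hFatou : E.HasFatouProperty) (h : InvEquivAlong E φ₁ φ₂ φ e ε C D) :
    EqWithEquivNorms (prod (E.calderonLozanovskii φ₁)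
        (multipliers (E.calderonLozanovskii φ₁) (E.calderonLozanovskii φ)))
      (E.calderonLozanovskii φ) := by
  obtain ⟨A, hA⟩ := h.exists_norm_mul_le hE
  have hM := h.multipliers_eq hE hFatou
  obtain ⟨a, b, ha, hb⟩ := hM.exists_le
  have hε4 : 0 < ε / 4 := div_pos h.pos four_pos
  set k : ℝ≥0 := max 1 (ε / 4)⁻¹ with hk
  have hfac : ∀ (z : Ω →ₘ[μ] ℝ) (l : ℝ≥0), (E.calderonLozanovskii φ).norm z < l →
      ∃ x₁ ∈ (E.calderonLozanovskii φ₁).carrier,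
        ∃ x₂ ∈ (multipliers (E.calderonLozanovskii φ₁) (E.calderonLozanovskii φ)).carrier,
          z = x₁ * x₂ ∧ (E.calderonLozanovskii φ₁).norm x₁ ≤ (max 1 ε * 1 : ℝ≥0) ∧
          (E.calderonLozanovskii φ₂).norm x₂ ≤ (max 1 ε * (k * l * D) : ℝ≥0) := by
    intro z l hl
    obtain ⟨x₁, x₂, h₁, h₂, rfl⟩ := h.exists_factorization hE (inBall_of_norm_lt' hE hε4 hl)
    exact ⟨x₁, h₁.mem_calderonLozanovskii hE, x₂, hM.1 ▸ h₂.mem_calderonLozanovskii hE, rfl,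
      calderonLozanovskii_norm_le_of_inBall hE h₁, calderonLozanovskii_norm_le_of_inBall hE h₂⟩
  have hsub : ∀ z ∈ (prod (E.calderonLozanovskii φ₁)
      (multipliers (E.calderonLozanovskii φ₁) (E.calderonLozanovskii φ))).carrier,
      z ∈ (E.calderonLozanovskii φ).carrier := by
    rintro _ ⟨x₁, hx₁, x₂, hx₂, rfl⟩
    exact (hA x₁ hx₁ x₂ (hM.1 ▸ hx₂)).1
  have htop := (normLike_calderonLozanovskii hE φ).norm_ne_top
  refine EqWithEquivNorms.of_le (C := a * (max 1 ε * max 1 ε * k * D)) (D := A * b)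
    (Subset.antisymm hsub fun z hz => ?_) (fun z hz => ?_) (fun z hz => ?_)
  · obtain ⟨l, hl, -⟩ := ENNReal.lt_iff_exists_nnreal_btwn.1 (lt_top_iff_ne_top.2 (htop z hz))
    obtain ⟨x₁, hx₁, x₂, hx₂, hzx, -⟩ := hfac z l hl
    exact ⟨x₁, hx₁, x₂, hx₂, hzx⟩
  · refine ennreal_le_mul_of_forall_gt (htop z (hsub z hz)) fun l hl => ?_
    obtain ⟨x₁, hx₁, x₂, hx₂, hzx, hn₁, hn₂⟩ := hfac z l hl
    have h1 : (prod (E.calderonLozanovskii φ₁)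
        (multipliers (E.calderonLozanovskii φ₁) (E.calderonLozanovskii φ))).norm z ≤
        (E.calderonLozanovskii φ₁).norm x₁ *
          (multipliers (E.calderonLozanovskii φ₁) (E.calderonLozanovskii φ)).norm x₂ :=
      iInf₂_le_of_le x₁ hx₁ (iInf₂_le_of_le x₂ hx₂ (iInf_le_of_le hzx le_rfl))
    calc _ ≤ _ := h1
      _ ≤ ((max 1 ε * 1 : ℝ≥0) : ℝ≥0∞) * (a * ((max 1 ε * (k * l * D) : ℝ≥0) : ℝ≥0∞)) :=
          mul_le_mul' hn₁ ((ha x₂ hx₂).trans (by gcongr))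
      _ = ((a * (max 1 ε * max 1 ε * k * D) : ℝ≥0) : ℝ≥0∞) * l := by
          rw [← ENNReal.coe_mul, ← ENNReal.coe_mul, ← ENNReal.coe_mul]
          congr 1; ring
  · have hM' := (normLike_calderonLozanovskii hE φ).multipliers
      (normLike_calderonLozanovskii hE φ₂) hM
    have htop' : (prod (E.calderonLozanovskii φ₁)
        (multipliers (E.calderonLozanovskii φ₁) (E.calderonLozanovskii φ))).norm z ≠ ∞ := by
      obtain ⟨x₁, hx₁, x₂, hx₂, hzx⟩ := hz
      refine ne_top_of_le_ne_top (ENNReal.mul_ne_top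
        ((normLike_calderonLozanovskii hE φ₁).norm_ne_top x₁ hx₁) (hM'.norm_ne_top x₂ hx₂)) ?_
      exact iInf₂_le_of_le x₁ hx₁ (iInf₂_le_of_le x₂ hx₂ (iInf_le_of_le hzx le_rfl))
    refine ennreal_le_mul_of_forall_gt htop' fun l hl => ?_
    simp only [prod, iInf_lt_iff] at hl
    obtain ⟨x₁, hx₁, x₂, hx₂, rfl, hlt⟩ := hl
    calc _ ≤ A * ((E.calderonLozanovskii φ₁).norm x₁ * (E.calderonLozanovskii φ₂).norm x₂) :=
          (hA x₁ hx₁ x₂ (hM.1 ▸ hx₂)).2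
      _ ≤ A * ((E.calderonLozanovskii φ₁).norm x₁ * (b *
          (multipliers (E.calderonLozanovskii φ₁) (E.calderonLozanovskii φ)).norm x₂)) := by
          gcongr; exact hb x₂ hx₂
      _ = A * b * ((E.calderonLozanovskii φ₁).norm x₁ *
          (multipliers (E.calderonLozanovskii φ₁) (E.calderonLozanovskii φ)).norm x₂) := by ring
      _ ≤ _ := by rw [ENNReal.coe_mul]; gcongr

end FunctionSpace

end PointwiseProduct

open PointwiseProduct FunctionSpace in
theorem theorem9 {Ω : Type*} [MeasurableSpace Ω] (μ : MeasureTheory.Measure Ω)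
    [MeasureTheory.SigmaFinite μ] [μ.IsComplete]
    (E : FunctionSpace μ) (hE : E.IsBanachIdealSpace) (hFatou : E.HasFatouProperty)
    (hsupp : E.HasFullSupport) (φ φ₁ : YoungFunction)
    (hφ : ∃ φ₂ : YoungFunction,
      YoungFunction.InvEquivAll φ₁ φ₂ φ ∨
      (YoungFunction.InvEquivLarge φ₁ φ₂ φ ∧ (linfty μ).Embeds E) ∨
      (YoungFunction.InvEquivSmall φ₁ φ₂ φ ∧ E.Embeds (linfty μ))) :
    (prod (E.calderonLozanovskii φ₁)
        (multipliers (E.calderonLozanovskii φ₁) (E.calderonLozanovskii φ))).EqWithEquivNorms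
      (E.calderonLozanovskii φ) ∧
    (E.calderonLozanovskii φ₁).IsPerfectUpToEquiv (E.calderonLozanovskii φ) := by
  obtain ⟨φ₂, hφ₂⟩ := hφ
  obtain ⟨e, ε, C, D, h⟩ := exists_invEquivAlong hE hsupp hφ₂
  have hM := h.multipliers_eq hE hFatou
  have hN := normLike_calderonLozanovskii hE φ
  have hN₂ := normLike_calderonLozanovskii hE φ₂
  exact ⟨h.prod_multipliers_eq hE hFatou,
    (hM.multipliers_left (hN.multipliers hN₂ hM) hN₂ hN).trans (h.swap.multipliers_eq hE hFatou)⟩
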